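/- \textbf{Setting.} Let $d,p\ge 1$ be integers, and let $f:\mathbb{R}^d\to\mathbb{R}$ be $\mathcal{C}^{2p}$ and such that 1. $f$ is coercive, i.e. $f(x)\to+\infty$ as $\|x\|\to+\infty$; 2. $\operatorname{argmin}(f)=\{0\}$ and $f(0)=0$; 3. $0$ is a strict polynomial local minimum of $f$ of order $2p$: it is a local minimum, and $p$ is the smallest integer for which there is $r>0$ with $\sum_{k=2}^{2p}\frac1{k!}\nabla^kf(0)\cdot h^{\otimes k}>0$ for all $h$ with $0<\|h\|<r$; 4. $e^{-f}\in L^1(\mathbb{R}^d)$. \textbf{Construction.} Put $F_0=\mathbb{R}^d$ and, for $1\le k\le p-1$, $$F_k=\{h\in F_{k-1}:\ \forall h'\in F_{k-1},\ \nabla^{2k}f(0)\cdot h\otimes h'^{\otimes(2k-1)}=0\}.$$ Let $E_k$ be the orthogonal complement of $F_k$ in $F_{k-1}$ for $1\le k\le p-1$, and let $E_p=F_{p-1}$, so that $\mathbb{R}^d=E_1\oplus\cdots\oplus E_p$. For $1\le i\le d$ let $j(i)$ be the index $j$ with $\dim E_1+\cdots+\dim E_{j-1}<i\le\dim E_1+\cdots+\dim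 E_j$, and put $\alpha_i=\frac1{2j(i)}$. Let $B$ be any orthogonal transformation of $\mathbb{R}^d$ with $Be_i\in E_{j(i)}$ for every $i$. With $p_E$ the orthogonal projection onto $E$, define $$g(h)=\sum_{k=2}^{2p}\frac1{k!}\sum_{\substack{i_1+\cdots+i_p=k\\ \frac{i_1}{2}+\frac{i_2}{4}+\cdots+\frac{i_p}{2p}=1}}\binom{k}{i_1,\dots,i_p}\nabla^kf(0)\cdot p_{E_1}(Bh)^{\otimes i_1}\otimes\cdots\otimes p_{E_p}(Bh)^{\otimes i_p}.$$ \textbf{Hypothesis when $p\ge5$.} If $p\ge5$, assume moreover that for all $h\in\mathbb{R}^d$ and all $(i_1,\dots,i_p)\in\{0,2,\dots,2p\}^p$ with $\frac{i_1}{2}+\cdots+\frac{i_p}{2p}<1$, $$\nabla^{i_1+\cdots+i_p}f(0)\cdot p_{E_1}(h)^{\otimes i_1}\otimes\cdots\otimes p_{E_p}(h)^{\otimes i_p}=0.$$ \textbf{Theorem.} Write $t^\alpha=(t^{\alpha_1},\dots,t^{\alpha_d})$ and let $*$ denote the element-wise product of vectors. Then: (a) for every $h\in\mathbb{R}^d$,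 $\ \frac1t\left[f(B(t^\alpha*h))-f(0)\right]\to g(h)$ as $t\to0^+$; (b) $g$ is constant in none of its variables: for each $i$ there are values of the other variables for which $h_i\mapsto g(h_1,\dots,h_d)$ is not constant; (c) if $g$ is coercive, then $e^{-g}\in L^1(\mathbb{R}^d)$, and if for $0<t\le1$ the random vector $X_t$ has the law $\pi_t$ with density $e^{-f(x)/t}/\int_{\mathbb{R}^d}e^{-f(y)/t}\,dy$, and $X$ is a random vector with density $e^{-g(x)}/\int_{\mathbb{R}^d}e^{-g(y)}\,dy$, then $$\left(\frac1{t^{\alpha_1}},\dots,\frac1{t^{\alpha_d}}\right)*(B^{-1}X_t)\ \longrightarrow\ X\quad\text{in law, as } t\to0^+ .$$ -/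

import Mathlib

open MeasureTheory ProbabilityTheory Filter
open scoped Topology

noncomputable section

namespace DegenerateGibbs

/-- `ℝ^d` with its Euclidean norm and inner product. -/
abbrev Rd (d : ℕ) : Type := EuclideanSpace ℝ (Fin d)

variable {d p : ℕ}

/-- Element-wise product `a ∗ b` of two vectors of `ℝ^d`. -/
def elemMul (a b : Rd d) : Rd d := WithLp.toLp 2 fun i => a i * b i

/-- The vector `t^a = (t^{a_1}, …, t^{a_d})`. -/
def powVec (t : ℝ) (a : Fin d → ℝ) : Rd d := WithLp.toLp 2 fun i => t ^ a i

/-- The vector `(1/t^{a_1}, …, 1/t^{a_d})`. -/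
def invPowVec (t : ℝ) (a : Fin d → ℝ) : Rd d := WithLp.toLp 2 fun i => 1 / t ^ a i

/-- `f(x) → +∞` as `‖x‖ → +∞`. -/
def Coercive (f : Rd d → ℝ) : Prop := Tendsto f (Bornology.cobounded (Rd d)) atTop

/-- The set of global minimizers of `f`. -/
def argmin (f : Rd d → ℝ) : Set (Rd d) := {x | ∀ y, f x ≤ f y}

/-- `g` is constant in none of its variables: for each `i` there are values of the other variables
for which `h_i ↦ g(h_1, …, h_d)` is not constant. -/
def NonconstantInEachVariable (g : Rd d → ℝ) : Prop :=
  ∀ i : Fin d, ∃ h h' : Rd d, (∀ j, j ≠ i → h j = h' j) ∧ g h ≠ g h'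

/-- The Taylor polynomial `∑_{k=2}^{2q} (1/k!) ∇^k f(x) · h^{⊗k}` is positive for all small
nonzero `h`. -/
def TaylorPositive (f : Rd d → ℝ) (x : Rd d) (q : ℕ) : Prop :=
  ∃ r > 0, ∀ h ∈ Metric.ball (0 : Rd d) r, h ≠ 0 →
    0 < ∑ k ∈ Finset.Icc 2 (2 * q),
      (1 / (k.factorial : ℝ)) * iteratedFDeriv ℝ k f x (fun _ => h)

/-- The class `𝒜_p^⋆(x)`: `f` is `C^{2p}` and has at `x` a strict polynomial local minimum of
order `2p`. -/
structure StrictPolynomialMin (p : ℕ) (x : Rd d) (f : Rd d → ℝ) : Prop where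
  contDiff : ContDiff ℝ ((2 * p : ℕ) : WithTop ℕ∞) f
  isLocalMin : IsLocalMin f x
  isLeast : IsLeast {q : ℕ | TaylorPositive f x q} p

/-- The subspaces `F_0 = ℝ^d` and
`F_{k+1} = {h ∈ F_k : ∀ h' ∈ F_k, ∇^{2(k+1)} f(x) · h ⊗ h'^{⊗ 2(k+1)-1} = 0}`.
The vector `Function.update (fun _ => h') 0 h` is `(h, h', …, h')`. -/
def subF (f : Rd d → ℝ) (x : Rd d) : ℕ → Submodule ℝ (Rd d)
  | 0 => ⊤
  | k + 1 =>
    { carrier := {h | h ∈ subF f x k ∧ ∀ h' ∈ subF f x k,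
        iteratedFDeriv ℝ (2 * k + 2) f x
          (Function.update (fun _ : Fin (2 * k + 2) => h') 0 h) = 0}
      add_mem' := by
        rintro a b ⟨ha, ha'⟩ ⟨hb, hb'⟩
        refine ⟨Submodule.add_mem _ ha hb, fun h' hh' => ?_⟩
        rw [ContinuousMultilinearMap.map_update_add, ha' h' hh', hb' h' hh', add_zero]
      zero_mem' := by
        refine ⟨Submodule.zero_mem _, fun h' _ => ?_⟩
        exact ContinuousMultilinearMap.map_coord_zero _ 0 (by simp)
      smul_mem' := by
        rintro c a ⟨ha, ha'⟩
        refine ⟨Submodule.smul_mem _ c ha, fun h' hh' => ?_⟩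
        rw [ContinuousMultilinearMap.map_update_smul, ha' h' hh', smul_zero] }

/-- The subspaces `E_1, …, E_p`, where `subE f x p j` is `E_{j+1}` for `j = 0, …, p-1`: `E_k` is the
orthogonal complement of `F_k` in `F_{k-1}` for `k ≤ p-1`, and `E_p = F_{p-1}`. -/
def subE (f : Rd d → ℝ) (x : Rd d) (p : ℕ) (j : Fin p) : Submodule ℝ (Rd d) :=
  if (j : ℕ) + 1 < p then (subF f x (j + 1))ᗮ ⊓ subF f x j else subF f x j

/-- The index `i` (counted from `0`) lies in the `j`-th block of the decomposition `E`:
`dim E_0 + ⋯ + dim E_{j-1} ≤ i < dim E_0 + ⋯ + dim E_j`. -/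
def InBlock (E : Fin p → Submodule ℝ (Rd d)) (j : Fin p) (i : Fin d) : Prop :=
  ∑ l ∈ Finset.Iio j, Module.finrank ℝ (E l) ≤ (i : ℕ) ∧
    (i : ℕ) < ∑ l ∈ Finset.Iic j, Module.finrank ℝ (E l)

/-- The orthogonal transformation `B` is adapted to the decomposition `E`. -/
def IsAdapted (E : Fin p → Submodule ℝ (Rd d)) (B : Rd d ≃ₗᵢ[ℝ] Rd d) : Prop :=
  ∀ (j : Fin p) (i : Fin d), InBlock E j i → B (EuclideanSpace.single i 1) ∈ E j

open Classical in
/-- The exponents: `α_i = 1/(2(j+1))` when `i` lies in the `j`-th block (`j` counted from `0`). -/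
def exponent (E : Fin p → Submodule ℝ (Rd d)) (i : Fin d) : ℝ :=
  ∑ j : Fin p, if InBlock E j i then 1 / (2 * ((j : ℕ) + 1) : ℝ) else 0

/-- The weight `i_1/2 + i_2/4 + ⋯ + i_p/(2p)`. -/
def weight (i : Fin p → ℕ) : ℚ := ∑ j : Fin p, (i j : ℚ) / (2 * ((j : ℕ) + 1))

/-- `∇^{i_1+⋯+i_p} f(x) · v_1^{⊗ i_1} ⊗ ⋯ ⊗ v_p^{⊗ i_p}`: the first `i_1` arguments are `v_1`,
the next `i_2` are `v_2`, and so on. -/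
def mixedTerm (f : Rd d → ℝ) (x : Rd d) (i : Fin p → ℕ) (v : Fin p → Rd d) : ℝ :=
  iteratedFDeriv ℝ (∑ j, i j) f x (fun m => v (finSigmaFinEquiv.symm m).1)

/-- The components `p_{E_1}(h), …, p_{E_p}(h)` of `h`. -/
def components (E : Fin p → Submodule ℝ (Rd d)) (h : Rd d) (j : Fin p) : Rd d :=
  (E j).starProjection h

/-- All even cross terms of weight less than `1` vanish. -/
def EvenCrossTermsVanish (f : Rd d → ℝ) (x : Rd d) (E : Fin p → Submodule ℝ (Rd d)) : Prop :=
  ∀ (h : Rd d) (i : Fin p → ℕ), (∀ j, Even (i j) ∧ i j ≤ 2 * p) → weight i < 1 →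
    mixedTerm f x i (components E h) = 0

/-- The function `g`: the sum of all terms of weight exactly `1` in the Taylor expansion of order
`2p` of `f` at `x`, expanded along the decomposition `E` and written in the basis `B`. -/
def limitFun (f : Rd d → ℝ) (x : Rd d) (E : Fin p → Submodule ℝ (Rd d)) (B : Rd d ≃ₗᵢ[ℝ] Rd d)
    (h : Rd d) : ℝ :=
  ∑ k ∈ Finset.Icc 2 (2 * p), (1 / (k.factorial : ℝ)) *
    ∑ i ∈ (Finset.piAntidiag (Finset.univ : Finset (Fin p)) k).filter (fun i => weight i = 1),
      (Nat.multinomial Finset.univ i : ℝ) * mixedTerm f x i (components E (B h))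

/-- The measure with density `e^{-f/t} / ∫ e^{-f/t}` with respect to Lebesgue measure. -/
def gibbs (f : Rd d → ℝ) (t : ℝ) : Measure (Rd d) :=
  volume.withDensity fun x =>
    ENNReal.ofReal ((∫ y, Real.exp (-f y / t))⁻¹ * Real.exp (-f x / t))

/-- The probability measure with density proportional to `e^{-g}` (when `e^{-g}` is integrable). -/
def expNegLaw (g : Rd d → ℝ) : Measure (Rd d) :=
  volume.withDensity fun x =>
    ENNReal.ofReal ((∫ y, Real.exp (-g y))⁻¹ * Real.exp (-g x))

end DegenerateGibbs

end

open DegenerateGibbs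

/-! Blocks are numbered from 0, so block j lies in `subF f 0 j` and carries the exponent 1/(2(j+1)).

(a) Expand the Taylor polynomial of `f` at 0 along the blocks. The substitution h ↦ B(t^α * h)
multiplies block j by t^(1/(2(j+1))), so the term of multi-index i is multiplied by t^(weight i).
For t ≤ 1 the argument is O(t^(1/(2p))), so the Peano remainder is o(t), locally uniformly in h.
After division by t, weights above 1 disappear and weight 1 gives g. Weights below 1 must vanish
identically (`weightPart_eq_zero`): the lowest nonzero part of weight w < 1 would be nonnegative, as
the limit of f/t^w with f ≥ 0. Yet its sum over all sign changes of the blocks is zero, because a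
multi-index with an odd entry cancels and the even cross terms vanish, by hypothesis if p ≥ 5 and by
combinatorics and polarization if p ≤ 4.

(b) On a single block E_j, g is the pure derivative of order 2j+2, up to a factor. Independence of
h_i would make this form invariant under translation by e = B e_i ∈ E_j. Before the last block this
puts e in `subF f 0 (j+1)`, to which it is orthogonal; on the last block it contradicts positivity
of the Taylor polynomial along ±e.

(c) g satisfies g(t^α * h) = t g(h). If it is coercive, it dominates a multiple of the gauge ∑
h_i^(2m_i) with α_i = 1/(2m_i), hence a Gaussian exponent, so e^(-g) is integrable. The joint limit
in (t, h) passes the same lower bound, with half the constant, to f near 0. Dominated convergence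
then handles a neighbourhood of 0, the rest is exponentially small (`tendsto_integral_rescaled`),
and a change of variables writes expectations under the rescaled Gibbs law as quotients of such
integrals. -/

/-! ### Symmetry of higher derivatives and polarization -/

section SymmetricDerivatives

variable {E F : Type*} [NormedAddCommGroup E] [NormedSpace ℝ E]
  [NormedAddCommGroup F] [NormedSpace ℝ F]

/-- Swapping the first two slots is the symmetry of the second derivative of the map left when the
remaining slots are frozen. A later swap reduces to lower order by peeling off the first slot. -/
theorem ContDiff.iteratedFDeriv_comp_swap_castSucc_succ {f : E → F} :
    ∀ {n : ℕ} (_ : ContDiff ℝ (n + 1 : ℕ) f) (i : Fin n) (x : E) (v : Fin (n + 1) → E),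
      iteratedFDeriv ℝ (n + 1) f x (v ∘ Equiv.swap i.castSucc i.succ) =
        iteratedFDeriv ℝ (n + 1) f x v
  | 0, _, i, _, _ => i.elim0
  | n + 1, hf, i, x, v => by
    have hd : ∀ y, DifferentiableAt ℝ (iteratedFDeriv ℝ (n + 1) f) y := fun y =>
      (hf.contDiffAt).differentiableAt_iteratedFDeriv (by exact_mod_cast Nat.lt_succ_self _)
    have hd' : ∀ y, DifferentiableAt ℝ (iteratedFDeriv ℝ n f) y := fun y =>
      (hf.contDiffAt).differentiableAt_iteratedFDeriv (by exact_mod_cast (by omega : n < n + 1 + 1))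
    rw [(hd x).iteratedFDeriv_succ_apply_left', (hd x).iteratedFDeriv_succ_apply_left']
    refine Fin.cases ?_ (fun j => ?_) i
    · have hd'' : ∀ (w : Fin (n + 1) → E), (fun y => iteratedFDeriv ℝ (n + 1) f y w) =
          fun y => fderiv ℝ (fun z => iteratedFDeriv ℝ n f z (Fin.tail w)) y (w 0) := fun w =>
        funext fun y => (hd' y).iteratedFDeriv_succ_apply_left'
      rw [hd'', hd'']
      have h0 : (v ∘ Equiv.swap (Fin.castSucc 0) (Fin.succ 0)) 0 = v 1 := by simp
      have h1 : Fin.tail (v ∘ Equiv.swap (Fin.castSucc 0) (Fin.succ 0)) 0 = v 0 := by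
        simp [Fin.tail]
      have h1' : Fin.tail v 0 = v 1 := by simp [Fin.tail]
      have h2 : Fin.tail (Fin.tail (v ∘ Equiv.swap (Fin.castSucc 0) (Fin.succ 0))) =
          Fin.tail (Fin.tail v) := by
        funext k
        simp only [Fin.tail, Function.comp_apply]
        rw [Equiv.swap_apply_of_ne_of_ne]
        · simp [Fin.ext_iff]
        · simp [Fin.ext_iff]
      rw [h0, h1, h1', h2]
      set G : E → F := fun z => iteratedFDeriv ℝ n f z (Fin.tail (Fin.tail v)) with hG
      have hGc : ContDiff ℝ 2 G := by
        have h3 : ContDiff ℝ 2 (iteratedFDeriv ℝ n f) :=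
          hf.iteratedFDeriv_right (by norm_cast; omega)
        exact (ContinuousMultilinearMap.apply ℝ (fun _ : Fin n => E) F
          (Fin.tail (Fin.tail v))).contDiff.comp h3
      have hfd : DifferentiableAt ℝ (fderiv ℝ G) x :=
        ((hGc.fderiv_right (m := 1) (by norm_num)).differentiable (by norm_num)) x
      have happ : ∀ a b, fderiv ℝ (fun y => fderiv ℝ G y a) x b = fderiv ℝ (fderiv ℝ G) x b a := by
        intro a b
        rw [fderiv_clm_apply hfd (differentiableAt_const a)]
        simp
      rw [happ, happ]
      exact (hGc.contDiffAt.isSymmSndFDerivAt (by simp)) _ _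
    · have h0 : (v ∘ Equiv.swap (Fin.castSucc j.succ) (Fin.succ j.succ)) 0 = v 0 := by
        simp only [Function.comp_apply]
        rw [Equiv.swap_apply_of_ne_of_ne] <;> simp [Fin.ext_iff]
      have h1 : Fin.tail (v ∘ Equiv.swap (Fin.castSucc j.succ) (Fin.succ j.succ)) =
          Fin.tail v ∘ Equiv.swap j.castSucc j.succ := by
        funext k
        simp only [Fin.tail, Function.comp_apply, Equiv.swap_apply_def, ← Fin.succ_castSucc,
          Fin.succ_inj]
        split_ifs <;> rfl
      rw [h0, h1]
      congr 2
      funext y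
      exact iteratedFDeriv_comp_swap_castSucc_succ (hf.of_le (by norm_cast; omega)) j y _

theorem ContDiff.iteratedFDeriv_comp_perm' {f : E → F} {n : ℕ} {N : WithTop ℕ∞}
    (hf : ContDiff ℝ N f) (hn : (n : WithTop ℕ∞) ≤ N) (σ : Equiv.Perm (Fin n)) (x : E)
    (v : Fin n → E) :
    iteratedFDeriv ℝ n f x (v ∘ σ) = iteratedFDeriv ℝ n f x v := by
  cases n with
  | zero => congr 1; funext i; exact i.elim0
  | succ n =>
    have hσ : σ ∈ Submonoid.closure
        (Set.range fun i : Fin n => Equiv.swap i.castSucc i.succ) := by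
      rw [Equiv.Perm.mclosure_swap_castSucc_succ]; trivial
    induction hσ using Submonoid.closure_induction generalizing v with
    | mem τ hτ =>
      obtain ⟨i, rfl⟩ := hτ
      exact (hf.of_le hn).iteratedFDeriv_comp_swap_castSucc_succ i x v
    | one => rfl
    | mul a b _ _ ha hb =>
      rw [Equiv.Perm.coe_mul, ← Function.comp_assoc, hb, ha]

/-- A symmetric multilinear map vanishing on the diagonal vanishes. -/
theorem ContinuousMultilinearMap.eq_zero_of_diagonal {n : ℕ} (M : E [×n]→L[ℝ] F)
    (hsymm : ∀ (σ : Equiv.Perm (Fin n)) v, M (v ∘ σ) = M v)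
    (hdiag : ∀ x, M (fun _ => x) = 0) : M = 0 := by
  ext v
  -- Polarization: the n-th derivative of x ↦ M(x, …, x) is the sum of M over all rearrangements of
  -- v, which symmetry turns into n! • M v.
  have h := M.iteratedFDeriv_comp_diagonal 0 v
  have h0 : (fun x => M (fun _ => x)) = fun _ => (0 : F) := funext hdiag
  rw [h0] at h
  have h1 : ∀ σ : Equiv.Perm (Fin n), M (fun i => v (σ i)) = M v := fun σ => hsymm σ v
  simp only [h1, Finset.sum_const, Finset.card_univ, Fintype.card_perm, Fintype.card_fin] at h
  have h2 : iteratedFDeriv ℝ n (fun _ : E => (0 : F)) 0 = 0 := by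
    have := iteratedFDeriv_fun_zero (𝕜 := ℝ) (E := E) (F := F) (n := n)
    exact congrFun this 0
  rw [h2] at h
  have h3 : ((n.factorial : ℝ)) • M v = 0 := by
    rw [Nat.cast_smul_eq_nsmul]; exact h.symm
  have h4 : (n.factorial : ℝ) ≠ 0 := by positivity
  simpa [h4] using h3

end SymmetricDerivatives

/-! ### Multinomial expansion of symmetric forms -/

section Multinomial

open Finset

/-- Both sides are the coefficient of one monomial in (∑ X_j)^k, computed by expanding over words
and by the multinomial theorem. -/
theorem card_filter_fiber_card_eq {ι : Type*} [Fintype ι] [DecidableEq ι] {k : ℕ} (i : ι → ℕ)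
    (hi : ∑ j, i j = k) :
    #{r : Fin k → ι | ∀ j, #{m | r m = j} = i j} = Nat.multinomial univ i := by
  have h1 : (∑ j : ι, (MvPolynomial.X j : MvPolynomial ι ℕ)) ^ k =
      ∑ r : Fin k → ι, MvPolynomial.monomial
        (Finsupp.equivFunOnFinite.symm fun j => #{m | r m = j}) 1 := by
    rw [← Fin.prod_const, Finset.prod_univ_sum, Fintype.piFinset_univ]
    refine Finset.sum_congr rfl fun r _ => ?_
    rw [MvPolynomial.monomial_eq, Finsupp.prod_fintype _ _ (by simp)]
    simp only [map_one, one_mul, Finsupp.equivFunOnFinite_symm_apply_apply]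
    rw [← Finset.prod_fiberwise (s := univ) (g := r)]
    refine Finset.prod_congr rfl fun j _ => ?_
    rw [← Finset.prod_const]
    exact Finset.prod_congr rfl fun m hm => by rw [(Finset.mem_filter.1 hm).2]
  have h2 : (∑ j : ι, (MvPolynomial.X j : MvPolynomial ι ℕ)) ^ k =
      ∑ i ∈ piAntidiag univ k, MvPolynomial.monomial
        (Finsupp.equivFunOnFinite.symm i) (Nat.multinomial univ i) := by
    rw [Finset.sum_pow_eq_sum_piAntidiag]
    refine Finset.sum_congr rfl fun r _ => ?_
    rw [MvPolynomial.monomial_eq, Finsupp.prod_fintype _ _ (by simp)]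
    simp
  have h3 := congrArg (MvPolynomial.coeff (Finsupp.equivFunOnFinite.symm i)) (h1.symm.trans h2)
  simp only [MvPolynomial.coeff_sum, MvPolynomial.coeff_monomial,
    EmbeddingLike.apply_eq_iff_eq] at h3
  rw [Finset.sum_ite_eq' , if_pos (by simp [hi]), Finset.sum_boole] at h3
  simpa [funext_iff] using h3

theorem exists_perm_comp_eq_of_fiber_card_eq {κ ι : Type*} [Fintype κ] [DecidableEq ι]
    {r s : κ → ι} (h : ∀ j, #{m | r m = j} = #{m | s m = j}) :
    ∃ σ : Equiv.Perm κ, s ∘ σ = r := by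
  have e : ∀ j, { a // r a = j } ≃ { b // s b = j } := fun j =>
    Fintype.equivOfCardEq (by rw [Fintype.card_subtype, Fintype.card_subtype, h j])
  exact ⟨Equiv.ofFiberEquiv e, funext fun a => Equiv.ofFiberEquiv_map e a⟩

theorem card_filter_finSigmaFinEquiv_symm_fst {p : ℕ} (i : Fin p → ℕ) (j : Fin p) :
    #{m : Fin (∑ j, i j) | (finSigmaFinEquiv.symm m).1 = j} = i j := by
  rw [← Fintype.card_subtype]
  rw [Fintype.card_congr (finSigmaFinEquiv.symm.subtypeEquiv (q := fun x => x.1 = j)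
    (fun _ => Iff.rfl))]
  rw [Fintype.card_congr (Equiv.sigmaSubtype (α := Fin p) (β := fun j => Fin (i j)) j)]
  simp

variable {d p : ℕ}

/-- Multinomial expansion of a derivative along a sum of vectors. -/
theorem iteratedFDeriv_sum_eq_sum_mixedTerm {f : Rd d → ℝ} {N : WithTop ℕ∞} (hf : ContDiff ℝ N f)
    {k : ℕ} (hk : (k : WithTop ℕ∞) ≤ N) (x : Rd d) (v : Fin p → Rd d) :
    iteratedFDeriv ℝ k f x (fun _ => ∑ j, v j) =
      ∑ i ∈ piAntidiag (univ : Finset (Fin p)) k,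
        (Nat.multinomial univ i : ℝ) * mixedTerm f x i v := by
  rw [ContinuousMultilinearMap.map_sum]
  have hmaps : ∀ r ∈ (univ : Finset (Fin k → Fin p)),
      (fun j => #{m | r m = j}) ∈ piAntidiag (univ : Finset (Fin p)) k := by
    intro r _
    simp only [mem_piAntidiag, mem_univ, implies_true, and_true]
    rw [← Finset.card_eq_sum_card_fiberwise (f := r) (s := univ) (t := univ) (by simp)]
    simp
  rw [← Finset.sum_fiberwise_of_maps_to hmaps]
  refine Finset.sum_congr rfl fun i hi => ?_
  have hik : ∑ j, i j = k := (mem_piAntidiag.1 hi).1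
  subst hik
  rw [← card_filter_fiber_card_eq i rfl, ← nsmul_eq_mul, ← Finset.sum_const]
  refine Finset.sum_congr ?_ fun r hr => ?_
  · ext r
    simp only [mem_filter, mem_univ, true_and, funext_iff]
  · have hr' : ∀ j, #{m | r m = j} = i j := by simpa using hr
    -- Every word with these letter counts is a rearrangement of the sorted word used by
    -- `mixedTerm`, so symmetry gives both the same value.
    obtain ⟨σ, hσ⟩ := exists_perm_comp_eq_of_fiber_card_eq (r := r)
      (s := fun m : Fin (∑ j, i j) => (finSigmaFinEquiv.symm m).1)
      (fun j => by rw [card_filter_finSigmaFinEquiv_symm_fst]; exact hr' j)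
    subst hσ
    exact hf.iteratedFDeriv_comp_perm' hk σ x fun m => v (finSigmaFinEquiv.symm m).1

end Multinomial

/-! ### Taylor's theorem with Peano remainder -/

section Taylor

variable {E : Type*} [NormedAddCommGroup E] [NormedSpace ℝ E]

open Asymptotics

/-- **Taylor's theorem** with Peano remainder in several variables. -/
theorem ContDiff.taylor_isLittleO_pow_norm {f : E → ℝ} {n : ℕ} (hf : ContDiff ℝ n f) (x : E) :
    (fun v => f (x + v) - ∑ k ∈ Finset.range (n + 1),
      (1 / (k.factorial : ℝ)) * iteratedFDeriv ℝ k f x (fun _ => v)) =o[𝓝 0]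
      fun v => ‖v‖ ^ n := by
  cases n with
  | zero =>
    have h1 : Tendsto (fun v => f (x + v)) (𝓝 0) (𝓝 (f x)) := by
      have := (hf.continuous.comp (continuous_const.add continuous_id)).tendsto (0 : E)
        (f := fun v => f (x + v))
      simpa using this
    simpa using h1.sub_const (f x)
  | succ n =>
    set D := iteratedFDeriv ℝ (n + 1) f with hD
    have hDc : Continuous D := hf.continuous_iteratedFDeriv (by simp)
    -- Integral remainder after degree n, with the term of degree n+1 moved under the integral: only
    -- the increment of D remains, and it is small by continuity.
    have key : ∀ v, f (x + v) - ∑ k ∈ Finset.range (n + 1 + 1),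
        (1 / (k.factorial : ℝ)) * iteratedFDeriv ℝ k f x (fun _ => v) =
        (n.factorial : ℝ)⁻¹ * ∫ t in (0 : ℝ)..1,
          (1 - t) ^ n * (D (x + t • v) (fun _ => v) - D x (fun _ => v)) := by
      intro v
      have hc1 : Continuous fun t : ℝ => (1 - t) ^ n * D (x + t • v) (fun _ => v) := by
        have : Continuous fun t : ℝ => D (x + t • v) (fun _ => v) :=
          (ContinuousMultilinearMap.apply ℝ (fun _ : Fin (n + 1) => E) ℝ
            (fun _ => v)).continuous.comp (hDc.comp (by fun_prop))
        fun_prop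
      have hc2 : Continuous fun t : ℝ => (1 - t) ^ n * D x (fun _ => v) := by fun_prop
      have hint : ∫ t in (0 : ℝ)..1, (1 - t) ^ n = ((n : ℝ) + 1)⁻¹ := by
        rw [intervalIntegral.integral_comp_sub_left (fun t => t ^ n) 1]
        simp
      have h1 := map_add_eq_sum_add_integral_iteratedFDeriv (f := f) (x := x) (y := v) (n := n)
        (fun t _ => by exact_mod_cast hf.contDiffAt)
      simp only [smul_eq_mul] at h1
      simp only [mul_sub]
      rw [intervalIntegral.integral_sub (hc1.intervalIntegrable _ _) (hc2.intervalIntegrable _ _),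
        intervalIntegral.integral_mul_const, hint, Finset.sum_range_succ, h1, Nat.factorial_succ]
      have h2 : (n.factorial : ℝ) ≠ 0 := by positivity
      have h3 : ((n : ℝ) + 1) ≠ 0 := by positivity
      simp only [one_div, hD]
      push_cast
      field_simp
      ring
    refine IsLittleO.of_bound fun c hc => ?_
    obtain ⟨δ, hδ, hball⟩ := Metric.continuousAt_iff.1 (hDc.continuousAt (x := x)) c hc
    filter_upwards [Metric.ball_mem_nhds (0 : E) hδ] with v hv
    rw [key v, norm_mul]
    have hb : ∀ t ∈ Set.uIoc (0 : ℝ) 1,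
        ‖(1 - t) ^ n * (D (x + t • v) (fun _ => v) - D x (fun _ => v))‖ ≤ c * ‖v‖ ^ (n + 1) := by
      intro t ht
      rw [Set.uIoc_of_le zero_le_one] at ht
      have ht1 : ‖(1 - t) ^ n‖ ≤ 1 := by
        rw [norm_pow]
        refine pow_le_one₀ (norm_nonneg _) ?_
        rw [Real.norm_eq_abs, abs_le]
        constructor <;> linarith [ht.1, ht.2]
      have hdist : ‖D (x + t • v) - D x‖ ≤ c := by
        rw [← dist_eq_norm]
        refine (hball ?_).le
        rw [dist_eq_norm, add_sub_cancel_left, norm_smul, Real.norm_eq_abs, abs_of_pos ht.1]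
        have : ‖v‖ < δ := by simpa using hv
        exact lt_of_le_of_lt (mul_le_of_le_one_left (norm_nonneg _) ht.2) this
      rw [norm_mul, ← sub_apply]
      calc _ ≤ 1 * ‖(D (x + t • v) - D x) (fun _ => v)‖ := by gcongr
        _ ≤ 1 * (‖D (x + t • v) - D x‖ * ‖v‖ ^ (n + 1)) := by
          gcongr
          refine (ContinuousMultilinearMap.le_opNorm _ _).trans ?_
          simp
        _ ≤ _ := by rw [one_mul]; gcongr
    have h4 := intervalIntegral.norm_integral_le_of_norm_le_const hb
    have h5 : ‖(n.factorial : ℝ)⁻¹‖ ≤ 1 := by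
      rw [norm_inv, Real.norm_natCast]
      exact inv_le_one_of_one_le₀ (by exact_mod_cast n.factorial_pos)
    calc _ ≤ 1 * (c * ‖v‖ ^ (n + 1)) := by
          refine mul_le_mul h5 (by simpa using h4) (norm_nonneg _) zero_le_one
      _ = _ := by simp

end Taylor

/-! ### The block decomposition and its scaling -/

section Blocks

open Finset

variable {d p : ℕ}

/-- The block of i is the least j whose cumulative dimension exceeds i. -/
theorem existsUnique_inBlock {E : Fin p → Submodule ℝ (Rd d)}
    (hE : ∑ j, Module.finrank ℝ (E j) = d) (i : Fin d) : ∃! j, InBlock E j i := by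
  have hp : p ≠ 0 := by
    rintro rfl
    simp only [univ_eq_empty, sum_empty] at hE
    exact absurd i.2 (by omega)
  obtain ⟨q, rfl⟩ := Nat.exists_eq_succ_of_ne_zero hp
  have hne : ({j | (i : ℕ) < ∑ l ∈ Iic j, Module.finrank ℝ (E l)} :
      Finset (Fin (q + 1))).Nonempty :=
    ⟨Fin.last q, by
      have : Iic (Fin.last q) = univ := by ext; simp [Fin.le_last]
      simp [this, hE]⟩
  obtain ⟨j, hj, hmin⟩ := Finset.exists_minimal hne
  simp only [mem_filter, mem_univ, true_and] at hj hmin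
  have hlow : ∑ l ∈ Iio j, Module.finrank ℝ (E l) ≤ (i : ℕ) := by
    revert hj hmin
    refine Fin.cases ?_ (fun j' => ?_) j
    · intro _ _
      have : Iio (0 : Fin (q + 1)) = ∅ := by ext; simp
      simp [this]
    · intro _ hmin
      by_contra! hlt
      have hI : Iio j'.succ = Iic j'.castSucc := by ext l; simp [Fin.lt_def, Fin.le_def]
      rw [hI] at hlt
      have := hmin hlt (Fin.castSucc_lt_succ).le
      exact absurd (Fin.castSucc_lt_succ (i := j')) (not_lt.2 this)
  refine ⟨j, ⟨hlow, hj⟩, fun l hl => ?_⟩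
  have aux : ∀ a b : Fin (q + 1), InBlock E a i → InBlock E b i → ¬ a < b := by
    intro a b ha hb hab
    have hsub : Iic a ⊆ Iio b := fun x hx => by
      simp only [mem_Iic, mem_Iio] at hx ⊢; exact hx.trans_lt hab
    have := Finset.sum_le_sum_of_subset (f := fun l => Module.finrank ℝ (E l)) hsub
    have h1 := ha.2
    have h2 := hb.1
    omega
  exact le_antisymm (not_lt.1 (aux j l ⟨hlow, hj⟩ hl)) (not_lt.1 (aux l j hl ⟨hlow, hj⟩))

theorem exponent_eq_of_inBlock {E : Fin p → Submodule ℝ (Rd d)} {b : Fin d → Fin p}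
    (hb : ∀ i j, InBlock E j i ↔ b i = j) (i : Fin d) :
    exponent E i = 1 / (2 * ((b i : ℕ) + 1) : ℝ) := by
  classical
  simp [exponent, hb]

theorem subF_succ_le (f : Rd d → ℝ) (x : Rd d) (k : ℕ) : subF f x (k + 1) ≤ subF f x k :=
  fun _ h => h.1

theorem subF_antitone (f : Rd d → ℝ) (x : Rd d) : Antitone (subF f x) :=
  antitone_nat_of_succ_le (subF_succ_le f x)

theorem subE_le_subF (f : Rd d → ℝ) (x : Rd d) (j : Fin p) : subE f x p j ≤ subF f x j := by
  rw [subE]; split_ifs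
  · exact inf_le_right
  · exact le_rfl

/-- For j < l, block l sits inside `subF f x (j + 1)`, whose orthogonal complement contains block j.
-/
theorem subE_isOrtho (f : Rd d → ℝ) (x : Rd d) {j l : Fin p} (h : j ≠ l) :
    subE f x p j ⟂ subE f x p l := by
  wlog hlt : j < l generalizing j l
  · exact (this h.symm (lt_of_le_of_ne (not_lt.1 hlt) h.symm)).symm
  have hlt' : (j : ℕ) + 1 ≤ l := hlt
  have h1 : subE f x p l ≤ subF f x (j + 1) :=
    (subE_le_subF f x l).trans (subF_antitone f x hlt')
  have h2 : subE f x p j ≤ (subF f x (j + 1))ᗮ := by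
    rw [subE, if_pos (by have := l.2; omega)]
    exact inf_le_left
  exact (Submodule.isOrtho_iff_le.2 (h2.trans (Submodule.orthogonal_le h1)))

/-- The dimensions telescope along the decreasing flag `subF`. -/
theorem sum_finrank_subE (f : Rd d → ℝ) (x : Rd d) (hp : p ≠ 0) :
    ∑ j, Module.finrank ℝ (subE f x p j) = d := by
  obtain ⟨q, rfl⟩ : ∃ q, p = q + 1 := ⟨p - 1, by omega⟩
  have h : ∀ q, ∑ j ∈ range q,
      Module.finrank ℝ ((subF f x (j + 1))ᗮ ⊓ subF f x j : Submodule ℝ (Rd d)) +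
      Module.finrank ℝ (subF f x q) = d := by
    intro q
    induction q with
    | zero =>
      rw [range_zero, sum_empty, zero_add, subF]
      exact finrank_top ℝ (Rd d) |>.trans finrank_euclideanSpace_fin
    | succ q ih =>
      rw [sum_range_succ]
      have := Submodule.finrank_add_inf_finrank_orthogonal (subF_succ_le f x q)
      omega
  rw [Fin.sum_univ_castSucc]
  have h1 : ∀ j : Fin q, subE f x (q + 1) j.castSucc = (subF f x (j + 1))ᗮ ⊓ subF f x j := by
    intro j
    rw [subE, if_pos (by simp)]
    rfl
  have h2 : subE f x (q + 1) (Fin.last q) = subF f x q := by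
    rw [subE, if_neg (by simp)]
    rfl
  rw [h2, Finset.sum_congr rfl fun j _ => by rw [h1 j], Fin.sum_univ_eq_sum_range
    (fun j => Module.finrank ℝ ((subF f x (j + 1))ᗮ ⊓ subF f x j : Submodule ℝ (Rd d)))]
  exact h q

variable {E : Fin p → Submodule ℝ (Rd d)} {B : Rd d ≃ₗᵢ[ℝ] Rd d} {b : Fin d → Fin p}

theorem components_apply_eq_sum (horth : ∀ j l, j ≠ l → E j ⟂ E l)
    (hB : ∀ i, B (EuclideanSpace.single i 1) ∈ E (b i)) (h : Rd d) (j : Fin p) :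
    components E (B h) j =
      ∑ i, if b i = j then h i • B (EuclideanSpace.single i 1) else 0 := by
  have hh : h = ∑ i, h i • EuclideanSpace.single i (1 : ℝ) := by
    ext k; simp [Finset.sum_apply, Pi.single_apply]
  conv_lhs => rw [hh]
  simp only [components, map_sum, map_smul]
  refine Finset.sum_congr rfl fun i _ => ?_
  split_ifs with hij
  · rw [Submodule.starProjection_eq_self_iff.2 (hij ▸ hB i)]
  · rw [(E j).starProjection_apply_eq_zero_iff.2, smul_zero]
    exact (horth _ _ hij) (hB i)

theorem sum_components (horth : ∀ j l, j ≠ l → E j ⟂ E l)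
    (hB : ∀ i, B (EuclideanSpace.single i 1) ∈ E (b i)) (h : Rd d) :
    ∑ j, components E (B h) j = B h := by
  have hh : h = ∑ i, h i • EuclideanSpace.single i (1 : ℝ) := by
    ext k; simp [Finset.sum_apply, Pi.single_apply]
  simp only [components_apply_eq_sum horth hB]
  rw [Finset.sum_comm]
  conv_rhs => rw [hh]
  simp

/-- Scaling every coordinate by a factor depending only on its block scales the components. -/
theorem components_apply_elemMul (horth : ∀ j l, j ≠ l → E j ⟂ E l)
    (hB : ∀ i, B (EuclideanSpace.single i 1) ∈ E (b i)) (c : Fin p → ℝ) (a h : Rd d)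
    (ha : ∀ i, a i = c (b i)) (j : Fin p) :
    components E (B (elemMul a h)) j = c j • components E (B h) j := by
  simp only [components_apply_eq_sum horth hB, Finset.smul_sum]
  refine Finset.sum_congr rfl fun i _ => ?_
  split_ifs with hij
  · rw [smul_smul, ← hij, ← ha]; rfl
  · simp

theorem mixedTerm_smul (f : Rd d → ℝ) (x : Rd d) (i : Fin p → ℕ) (c : Fin p → ℝ)
    (v : Fin p → Rd d) :
    mixedTerm f x i (fun j => c j • v j) = (∏ j, c j ^ i j) * mixedTerm f x i v := by
  rw [mixedTerm, ContinuousMultilinearMap.map_smul_univ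
    (c := fun m => c (finSigmaFinEquiv.symm m).1)
    (m := fun m => v (finSigmaFinEquiv.symm m).1), smul_eq_mul, mixedTerm]
  congr 1
  rw [← Fintype.prod_equiv (finSigmaFinEquiv (n := i)) (fun x => c x.1) _ (by simp),
    Fintype.prod_sigma]
  simp

theorem continuous_mixedTerm (f : Rd d → ℝ) (x : Rd d) (i : Fin p → ℕ) :
    Continuous (mixedTerm f x i) :=
  (iteratedFDeriv ℝ (∑ j, i j) f x).cont.comp (by fun_prop)

theorem prod_rpow_pow_eq_rpow_weight {t : ℝ} (ht : 0 < t) (i : Fin p → ℕ) :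
    ∏ j : Fin p, (t ^ (1 / (2 * ((j : ℕ) + 1) : ℝ))) ^ i j = t ^ (weight i : ℝ) := by
  rw [weight]
  push_cast
  rw [Real.rpow_sum_of_pos ht]
  refine Finset.prod_congr rfl fun j _ => ?_
  rw [← Real.rpow_mul_natCast ht.le]
  congr 1
  ring

theorem continuous_components (E : Fin p → Submodule ℝ (Rd d)) : Continuous (components E) :=
  continuous_pi fun j => (E j).starProjection.continuous

end Blocks

/-! ### Even cross terms of weight below 1 vanish when p ≤ 4 -/

section EvenCrossTerms

variable {d p : ℕ}

/-- Symmetry moves the distinguished vector to slot 0. Freezing it there leaves a symmetric form on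
`subF f x k` that is zero on the diagonal by definition of `subF f x (k + 1)`, hence zero by
polarization. -/
theorem iteratedFDeriv_eq_zero_of_mem_subF {f : Rd d → ℝ} {N : WithTop ℕ∞} (hf : ContDiff ℝ N f)
    {k n : ℕ} (hk : n = 2 * k + 2) (hn : (n : WithTop ℕ∞) ≤ N) {x : Rd d} {u : Fin n → Rd d}
    (hu : ∀ m, u m ∈ subF f x k) {m₀ : Fin n} (hm₀ : u m₀ ∈ subF f x (k + 1)) :
    iteratedFDeriv ℝ n f x u = 0 := by
  subst hk
  wlog hm : m₀ = 0 generalizing u m₀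
  · rw [← hf.iteratedFDeriv_comp_perm' hn (Equiv.swap m₀ 0)]
    exact this (m₀ := 0) (fun m => hu _) (by simpa using hm₀) rfl
  subst hm
  set D := iteratedFDeriv ℝ (2 * k + 2) f x with hD
  have hsymm : ∀ (σ : Equiv.Perm (Fin (2 * k + 2))) v, D (v ∘ σ) = D v := fun σ v =>
    hf.iteratedFDeriv_comp_perm' hn σ x v
  let M : (subF f x k) [×(2 * k + 1)]→L[ℝ] ℝ :=
    (D.curryLeft (u 0)).compContinuousLinearMap fun _ => (subF f x k).subtypeL
  have hM : M = 0 := by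
    refine M.eq_zero_of_diagonal (fun σ v => ?_) fun w => ?_
    · change D (Fin.cons (u 0) _) = D (Fin.cons (u 0) _)
      -- This permutation fixes slot 0 and acts as σ on the others.
      refine Eq.trans ?_ (hsymm (Equiv.Perm.decomposeFin.symm (0, σ)) _)
      congr 1
      funext m
      refine Fin.cases ?_ (fun m => ?_) m
      · simp
      · simp
    · change D (Fin.cons (u 0) _) = 0
      rw [← hm₀.2 w w.2]
      congr 1
      funext m
      refine Fin.cases ?_ (fun m => ?_) m
      · simp
      · simp
  have h := congrArg (fun M => M fun m => ⟨Fin.tail u m, hu _⟩) hM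
  change D (Fin.cons (u 0) (Fin.tail u)) = 0 at h
  rwa [Fin.cons_self_tail] at h

/-- The combinatorial reason why p ≤ 4 needs no extra hypothesis: the blocks involved lie deep
enough in the flag for the derivative of this order to vanish. It fails for p = 5: exponents 2 and 4
on blocks 1 and 4 give weight 9/10 and k = 2, but block 1 comes before k. -/
theorem le_of_weight_lt_one_of_le_four (hp : p ≤ 4) {i : Fin p → ℕ} (hi : ∀ j, Even (i j))
    (hw : weight i < 1) {k : ℕ} (hk : ∑ j, i j = 2 * k + 2) :
    (∀ j, 0 < i j → k ≤ j) ∧ ∃ j, 0 < i j ∧ k + 1 ≤ j := by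
  choose a ha using hi
  obtain rfl : i = fun j => a j + a j := funext ha
  have hw' : ∑ j : Fin p, (a j : ℚ) / ((j : ℕ) + 1) < 1 := by
    refine lt_of_eq_of_lt (Finset.sum_congr rfl fun j _ => ?_) hw
    have : ((j : ℕ) : ℚ) + 1 ≠ 0 := by positivity
    push_cast
    field_simp
    ring
  clear hw ha
  -- 12 clears the denominators 1, 2, 3, 4, which makes the weight condition an integer inequality.
  have hcast : ∀ m : ℕ, ((m : ℚ) < 1 * 12) → m < 12 := fun m h => by
    have : (m : ℚ) < (12 : ℕ) := by simpa using h
    exact_mod_cast this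
  interval_cases p
  · simp at hk
  · simp [Fin.forall_fin_succ] at *
    omega
  · simp only [Fin.sum_univ_two, Fin.forall_fin_succ, Fin.exists_fin_succ] at *
    have h1 := hcast (12 * a 0 + 6 * a 1) (by push_cast; norm_num at hw'; linarith)
    simp
    omega
  · simp only [Fin.sum_univ_three, Fin.forall_fin_succ, Fin.exists_fin_succ] at *
    have h1 := hcast (12 * a 0 + 6 * a 1 + 4 * a 2) (by push_cast; norm_num at hw'; linarith)
    simp
    omega
  · simp only [Fin.sum_univ_four, Fin.forall_fin_succ, Fin.exists_fin_succ] at *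
    have h1 := hcast (12 * a 0 + 6 * a 1 + 4 * a 2 + 3 * a 3)
      (by push_cast; norm_num at hw'; linarith)
    simp
    omega

theorem evenCrossTermsVanish_of_le_four {f : Rd d → ℝ}
    (hf : ContDiff ℝ ((2 * p : ℕ) : WithTop ℕ∞) f) {x : Rd d} (hx : f x = 0) (hp : p ≤ 4) :
    EvenCrossTermsVanish f x (subE f x p) := by
  intro h i hi hw
  -- The zero multi-index is even of weight 0, and its term is the value of f at x.
  by_cases h0 : ∑ j, i j = 0
  · have h1 : ∀ n (u : Fin n → Rd d), n = 0 → iteratedFDeriv ℝ n f x u = f x := by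
      rintro n u rfl; simp
    rw [mixedTerm, h1 _ _ h0, hx]
  · obtain ⟨k, hk⟩ : ∃ k, ∑ j, i j = 2 * k + 2 := by
      obtain ⟨a, ha⟩ : Even (∑ j, i j) := by
        exact Finset.even_sum _ fun j _ => (hi j).1
      exact ⟨a - 1, by omega⟩
    obtain ⟨hle, j₀, hj₀, hj₀'⟩ := le_of_weight_lt_one_of_le_four hp (fun j => (hi j).1) hw hk
    have hmem : ∀ j : Fin p, components (subE f x p) h j ∈ subF f x j := fun j =>
      subE_le_subF f x j (Submodule.starProjection_apply_mem _ _)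
    refine iteratedFDeriv_eq_zero_of_mem_subF hf hk (by norm_cast; have := j₀.2; omega)
      (fun m => ?_)
      (m₀ := finSigmaFinEquiv ⟨j₀, ⟨0, hj₀⟩⟩) ?_
    · refine subF_antitone f x (hle _ ?_) (hmem _)
      exact Fin.pos (finSigmaFinEquiv.symm m).2
    · simp only [Equiv.symm_apply_apply]
      exact subF_antitone f x hj₀' (hmem _)

end EvenCrossTerms

/-! ### Expansion by weights and the rescaled limit -/

section Expansion

open Finset

variable {d p : ℕ}

/-- The multi-indices of total degree at most `2p`. -/
def taylorIndices (p : ℕ) : Finset (Fin p → ℕ) :=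
  (range (2 * p + 1)).biUnion fun k => piAntidiag univ k

theorem mem_taylorIndices {i : Fin p → ℕ} : i ∈ taylorIndices p ↔ ∑ j, i j ≤ 2 * p := by
  simp [taylorIndices]

theorem sum_taylorIndices (F : (Fin p → ℕ) → ℝ) :
    ∑ i ∈ taylorIndices p, F i = ∑ k ∈ range (2 * p + 1), ∑ i ∈ piAntidiag univ k, F i := by
  refine Finset.sum_biUnion fun a _ b _ hab => ?_
  rw [Function.onFun, Finset.disjoint_left]
  intro i hi hi'
  exact hab ((mem_piAntidiag.1 hi).1.symm.trans (mem_piAntidiag.1 hi').1)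

/-- The term of multi-index `i` in the Taylor expansion of `f` at `0` along the blocks `E`. -/
noncomputable def blockTerm (f : Rd d → ℝ) (E : Fin p → Submodule ℝ (Rd d)) (B : Rd d ≃ₗᵢ[ℝ] Rd d)
    (i : Fin p → ℕ) (h : Rd d) : ℝ :=
  (1 / ((∑ j, i j).factorial : ℝ)) *
    ((Nat.multinomial univ i : ℝ) * mixedTerm f 0 i (components E (B h)))

/-- The sum of the terms of weight `w` in the Taylor expansion of `f` at `0`. -/
noncomputable def weightPart (f : Rd d → ℝ) (E : Fin p → Submodule ℝ (Rd d)) (B : Rd d ≃ₗᵢ[ℝ] Rd d)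
    (w : ℚ) (h : Rd d) : ℝ :=
  ∑ i ∈ (taylorIndices p).filter (fun i => weight i = w), blockTerm f E B i h

/-- The weights that occur in the Taylor expansion of order `2p`, together with `1`. -/
def taylorWeights (p : ℕ) : Finset ℚ := insert 1 ((taylorIndices p).image weight)

variable {f : Rd d → ℝ} {E : Fin p → Submodule ℝ (Rd d)} {B : Rd d ≃ₗᵢ[ℝ] Rd d}
  {b : Fin d → Fin p}

theorem continuous_blockTerm (i : Fin p → ℕ) : Continuous (blockTerm f E B i) := by
  have h : Continuous fun h => mixedTerm f 0 i (components E (B h)) :=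
    (continuous_mixedTerm f 0 i).comp ((continuous_components E).comp B.continuous)
  exact continuous_const.mul (continuous_const.mul h)

theorem continuous_weightPart (w : ℚ) : Continuous (weightPart f E B w) :=
  continuous_finsetSum _ fun i _ => continuous_blockTerm i

theorem weight_le_half_sum (i : Fin p → ℕ) : weight i ≤ ((∑ j, i j : ℕ) : ℚ) / 2 := by
  rw [weight, Nat.cast_sum, Finset.sum_div]
  refine Finset.sum_le_sum fun j _ => ?_
  have : (0 : ℚ) ≤ (j : ℕ) := by positivity
  exact div_le_div_of_nonneg_left (by positivity) (by norm_num) (by linarith)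

/-- Weight is at most half the degree, so weight 1 forces degree at least 2: the degrees 0 and 1
absent from `limitFun` contribute nothing. -/
theorem limitFun_eq_weightPart : limitFun f 0 E B = weightPart f E B 1 := by
  funext h
  rw [weightPart, Finset.sum_filter, sum_taylorIndices, limitFun]
  simp only [← Finset.sum_filter]
  refine (Finset.sum_subset (fun k hk => ?_) fun k hk hk' => ?_).trans
    (Finset.sum_congr rfl fun k hk => ?_)
  · simp only [mem_Icc, mem_range] at hk ⊢; omega
  · rw [Finset.filter_eq_empty_iff.2, Finset.sum_empty, mul_zero]
    intro i hi hw
    have h1 := weight_le_half_sum i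
    rw [(mem_piAntidiag.1 hi).1, hw] at h1
    have h2 : (2 : ℚ) ≤ k := by linarith
    have h3 : 2 ≤ k := by exact_mod_cast h2
    simp only [mem_Icc, mem_range] at hk hk'
    omega
  · rw [Finset.mul_sum]
    refine Finset.sum_congr rfl fun i hi => ?_
    rw [blockTerm, (mem_piAntidiag.1 (Finset.mem_filter.1 hi).1).1]

theorem continuous_limitFun : Continuous (limitFun f 0 E B) :=
  limitFun_eq_weightPart (f := f) (E := E) (B := B) ▸ continuous_weightPart 1

theorem blockTerm_elemMul (horth : ∀ j l, j ≠ l → E j ⟂ E l)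
    (hB : ∀ i, B (EuclideanSpace.single i 1) ∈ E (b i)) (c : Fin p → ℝ) (a h : Rd d)
    (ha : ∀ i, a i = c (b i)) (i : Fin p → ℕ) :
    blockTerm f E B i (elemMul a h) = (∏ j, c j ^ i j) * blockTerm f E B i h := by
  have h1 : components E (B (elemMul a h)) = fun j => c j • components E (B h) j :=
    funext (components_apply_elemMul horth hB c a h ha)
  rw [blockTerm, h1, mixedTerm_smul, blockTerm]
  ring

theorem blockTerm_powVec (horth : ∀ j l, j ≠ l → E j ⟂ E l)
    (hB : ∀ i, B (EuclideanSpace.single i 1) ∈ E (b i)) {α : Fin d → ℝ}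
    (hα : ∀ i, α i = 1 / (2 * ((b i : ℕ) + 1) : ℝ)) {t : ℝ} (ht : 0 < t) (h : Rd d)
    (i : Fin p → ℕ) :
    blockTerm f E B i (elemMul (powVec t α) h) = t ^ (weight i : ℝ) * blockTerm f E B i h := by
  rw [blockTerm_elemMul horth hB (fun j => t ^ (1 / (2 * ((j : ℕ) + 1) : ℝ))) _ _
    (fun i => by simp [powVec, hα]), prod_rpow_pow_eq_rpow_weight ht]

theorem limitFun_powVec (horth : ∀ j l, j ≠ l → E j ⟂ E l)
    (hB : ∀ i, B (EuclideanSpace.single i 1) ∈ E (b i)) {α : Fin d → ℝ}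
    (hα : ∀ i, α i = 1 / (2 * ((b i : ℕ) + 1) : ℝ)) {t : ℝ} (ht : 0 < t) (h : Rd d) :
    limitFun f 0 E B (elemMul (powVec t α) h) = t * limitFun f 0 E B h := by
  rw [limitFun_eq_weightPart, weightPart, weightPart, Finset.mul_sum]
  refine Finset.sum_congr rfl fun i hi => ?_
  rw [blockTerm_powVec horth hB hα ht, (Finset.mem_filter.1 hi).2]
  simp

theorem sum_blockTerm_eq_taylor (hf : ContDiff ℝ ((2 * p : ℕ) : WithTop ℕ∞) f)
    (horth : ∀ j l, j ≠ l → E j ⟂ E l)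
    (hB : ∀ i, B (EuclideanSpace.single i 1) ∈ E (b i)) (h : Rd d) :
    ∑ i ∈ taylorIndices p, blockTerm f E B i h = ∑ k ∈ range (2 * p + 1),
      (1 / (k.factorial : ℝ)) * iteratedFDeriv ℝ k f 0 (fun _ => B h) := by
  rw [sum_taylorIndices]
  refine Finset.sum_congr rfl fun k hk => ?_
  have hk' : (k : WithTop ℕ∞) ≤ ((2 * p : ℕ) : WithTop ℕ∞) := by
    have := mem_range.1 hk
    exact_mod_cast (by omega : k ≤ 2 * p)
  rw [← sum_components horth hB h, iteratedFDeriv_sum_eq_sum_mixedTerm hf hk', Finset.mul_sum]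
  refine Finset.sum_congr rfl fun i hi => ?_
  rw [blockTerm, (mem_piAntidiag.1 hi).1]

theorem sum_blockTerm_powVec (horth : ∀ j l, j ≠ l → E j ⟂ E l)
    (hB : ∀ i, B (EuclideanSpace.single i 1) ∈ E (b i)) {α : Fin d → ℝ}
    (hα : ∀ i, α i = 1 / (2 * ((b i : ℕ) + 1) : ℝ)) {t : ℝ} (ht : 0 < t) (h : Rd d) :
    ∑ i ∈ taylorIndices p, blockTerm f E B i (elemMul (powVec t α) h) =
      ∑ w ∈ taylorWeights p, t ^ (w : ℝ) * weightPart f E B w h := by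
  rw [← Finset.sum_fiberwise_of_maps_to (t := taylorWeights p) (g := weight)
    (fun i hi => Finset.mem_insert_of_mem (Finset.mem_image_of_mem _ hi))]
  refine Finset.sum_congr rfl fun w _ => ?_
  rw [weightPart, Finset.mul_sum]
  refine Finset.sum_congr rfl fun i hi => ?_
  rw [blockTerm_powVec horth hB hα ht, (Finset.mem_filter.1 hi).2]

open Asymptotics in
/-- Rescaled Taylor expansion, with a remainder that is uniform near every `h₀`. -/
theorem tendsto_rescaled_remainder (hf : ContDiff ℝ ((2 * p : ℕ) : WithTop ℕ∞) f)
    (horth : ∀ j l, j ≠ l → E j ⟂ E l) (hp : p ≠ 0)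
    (hB : ∀ i, B (EuclideanSpace.single i 1) ∈ E (b i)) {α : Fin d → ℝ}
    (hα : ∀ i, α i = 1 / (2 * ((b i : ℕ) + 1) : ℝ)) (h₀ : Rd d) :
    Tendsto (fun q : ℝ × Rd d => (f (B (elemMul (powVec q.1 α) q.2)) -
      ∑ w ∈ taylorWeights p, q.1 ^ (w : ℝ) * weightPart f E B w q.2) / q.1)
      (𝓝[>] 0 ×ˢ 𝓝 h₀) (𝓝 0) := by
  set l : Filter (ℝ × Rd d) := 𝓝[>] 0 ×ˢ 𝓝 h₀ with hl
  set v : ℝ × Rd d → Rd d := fun q => B (elemMul (powVec q.1 α) q.2) with hv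
  have hpos : ∀ᶠ q in l, q.1 ∈ Set.Ioc (0 : ℝ) 1 :=
    tendsto_fst.eventually (Ioc_mem_nhdsGT zero_lt_one)
  have hfst : Tendsto Prod.fst l (𝓝 (0 : ℝ)) :=
    (tendsto_fst (f := 𝓝[>] (0 : ℝ)) (g := 𝓝 h₀)).mono_right nhdsWithin_le_nhds
  set C : Rd d → ℝ := fun h => ∑ j, ‖components E (B h) j‖ with hC
  have hCc : Continuous C := continuous_finsetSum _ fun j _ =>
    ((continuous_apply j).comp ((continuous_components E).comp B.continuous)).norm
  -- Every block exponent is at least 1/(2p), so for t ≤ 1 each block shrinks at least as fast as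
  -- t^(1/(2p)). The 2p-th power of the norm is then O(t).
  have hvle : ∀ q : ℝ × Rd d, q.1 ∈ Set.Ioc (0 : ℝ) 1 →
      ‖v q‖ ≤ q.1 ^ (1 / (2 * p : ℝ)) * C q.2 := by
    intro q hq
    change ‖B (elemMul (powVec q.1 α) q.2)‖ ≤ _ * ∑ j, _
    rw [← sum_components horth hB, Finset.mul_sum]
    refine (norm_sum_le _ _).trans (Finset.sum_le_sum fun j _ => ?_)
    rw [components_apply_elemMul horth hB (fun j => q.1 ^ (1 / (2 * ((j : ℕ) + 1) : ℝ))) _ _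
      (fun i => by simp [powVec, hα]), norm_smul, Real.norm_eq_abs,
      abs_of_pos (Real.rpow_pos_of_pos hq.1 _)]
    refine mul_le_mul_of_nonneg_right ?_ (norm_nonneg _)
    refine Real.rpow_le_rpow_of_exponent_ge hq.1 hq.2 ?_
    have h1 : (((j : ℕ) + 1 : ℕ) : ℝ) ≤ p := by exact_mod_cast j.2
    push_cast at h1
    have h2 : (0 : ℝ) ≤ (j : ℕ) := by positivity
    exact one_div_le_one_div_of_le (by positivity) (by linarith)
  have hCl : Tendsto (fun q : ℝ × Rd d => C q.2) l (𝓝 (C h₀)) :=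
    (hCc.tendsto h₀).comp tendsto_snd
  have hppos : (0 : ℝ) < 2 * p := by positivity
  have hv0 : Tendsto v l (𝓝 0) := by
    have h1 : Tendsto (fun q : ℝ × Rd d => q.1 ^ (1 / (2 * p : ℝ)) * C q.2) l (𝓝 0) := by
      have h2 : Tendsto (fun q : ℝ × Rd d => q.1 ^ (1 / (2 * p : ℝ))) l (𝓝 0) := by
        have := (Real.continuousAt_rpow_const 0 (1 / (2 * p : ℝ))
          (Or.inr (by positivity))).tendsto.comp hfst
        rw [Real.zero_rpow (by positivity)] at this
        exact this
      simpa using h2.mul hCl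
    exact squeeze_zero_norm' (hpos.mono fun q hq => hvle q hq) h1
  have hR := (hf.taylor_isLittleO_pow_norm 0).comp_tendsto hv0
  have hO : (fun q => ‖v q‖ ^ (2 * p)) =O[l] (fun q : ℝ × Rd d => q.1) := by
    have h1 : (fun q => ‖v q‖ ^ (2 * p)) =O[l] fun q : ℝ × Rd d => q.1 * C q.2 ^ (2 * p) := by
      refine IsBigO.of_bound 1 (hpos.mono fun q hq => ?_)
      rw [one_mul, norm_pow, norm_norm]
      refine (pow_le_pow_left₀ (norm_nonneg _) (hvle q hq) _).trans (le_of_eq ?_)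
      rw [mul_pow, ← Real.rpow_mul_natCast hq.1.le]
      have h2 : 1 / (2 * p : ℝ) * ((2 * p : ℕ) : ℝ) = 1 := by
        push_cast; field_simp
      rw [h2, Real.rpow_one, Real.norm_eq_abs, abs_of_nonneg]
      exact mul_nonneg hq.1.le (pow_nonneg (Finset.sum_nonneg fun j _ => norm_nonneg _) _)
    refine h1.trans ?_
    simpa using (isBigO_refl (fun q : ℝ × Rd d => q.1) l).mul ((hCl.pow (2 * p)).isBigO_one ℝ)
  refine ((hR.trans_isBigO hO).tendsto_div_nhds_zero).congr' (hpos.mono fun q hq => ?_)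
  simp only [Function.comp_apply, zero_add]
  rw [← sum_blockTerm_powVec horth hB hα hq.1, sum_blockTerm_eq_taylor hf horth hB]

/-- The average over sign changes of the blocks kills everything but the even cross terms. -/
theorem sum_sign_weightPart (horth : ∀ j l, j ≠ l → E j ⟂ E l)
    (hB : ∀ i, B (EuclideanSpace.single i 1) ∈ E (b i)) (heven : EvenCrossTermsVanish f 0 E)
    {w : ℚ} (hw : w < 1) (h : Rd d) :
    ∑ ε : Fin p → Bool, weightPart f E B w
      (elemMul (WithLp.toLp 2 fun i => if ε (b i) then (1 : ℝ) else -1) h) = 0 := by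
  simp only [weightPart]
  rw [Finset.sum_comm]
  refine Finset.sum_eq_zero fun i hi => ?_
  obtain ⟨hi, hiw⟩ := Finset.mem_filter.1 hi
  simp only [fun ε : Fin p → Bool => blockTerm_elemMul (f := f) horth hB
    (fun j => if ε j then (1 : ℝ) else -1)
    (WithLp.toLp 2 fun i => if ε (b i) then (1 : ℝ) else -1) h (fun i => rfl) i]
  rw [← Finset.sum_mul]
  by_cases hev : ∀ j, Even (i j)
  · rw [blockTerm, heven (B h) i (fun j => ⟨hev j, ?_⟩) (hiw ▸ hw)]
    · simp
    · exact (Finset.single_le_sum (fun _ _ => Nat.zero_le _) (mem_univ j)).trans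
        (mem_taylorIndices.1 hi)
  · push Not at hev
    obtain ⟨j, hj⟩ := hev
    -- The sum over signs factors over the blocks, and a block with odd exponent contributes 1 +
    -- (-1) = 0.
    have h1 := Finset.prod_univ_sum (fun _ : Fin p => (univ : Finset Bool))
      (fun j e => (if e then (1 : ℝ) else -1) ^ i j)
    rw [Fintype.piFinset_univ] at h1
    rw [← h1, Finset.prod_eq_zero (mem_univ j), zero_mul]
    simp [Nat.not_even_iff_odd.1 hj |>.neg_one_pow]

/-- All parts of weight less than one vanish. -/
theorem weightPart_eq_zero (hf : ContDiff ℝ ((2 * p : ℕ) : WithTop ℕ∞) f)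
    (hnonneg : ∀ x, 0 ≤ f x) (horth : ∀ j l, j ≠ l → E j ⟂ E l) (hp : p ≠ 0)
    (hB : ∀ i, B (EuclideanSpace.single i 1) ∈ E (b i)) (heven : EvenCrossTermsVanish f 0 E)
    {w : ℚ} (hw : w < 1) (h : Rd d) : weightPart f E B w h = 0 := by
  classical
  by_cases hwT : w ∈ taylorWeights p
  swap
  · rw [weightPart, Finset.filter_eq_empty_iff.2, Finset.sum_empty]
    rintro i hi rfl
    exact hwT (Finset.mem_insert_of_mem (Finset.mem_image_of_mem _ hi))
  obtain ⟨α, hα⟩ : ∃ α : Fin d → ℝ, ∀ i, α i = 1 / (2 * ((b i : ℕ) + 1) : ℝ) := ⟨_, fun _ => rfl⟩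
  by_contra hne
  have hbad : ((taylorWeights p).filter
      fun w => w < 1 ∧ ∃ h, weightPart f E B w h ≠ 0).Nonempty :=
    ⟨w, by simp only [mem_filter]; exact ⟨hwT, hw, h, hne⟩⟩
  clear hne hwT hw h w
  -- The least weight below 1 whose part is not identically zero.
  obtain ⟨w, hwmem, hmin⟩ := Finset.exists_minimal hbad
  simp only [mem_filter] at hwmem hmin
  obtain ⟨hwT, hw, h, hne⟩ := hwmem
  have hlow : ∀ w' ∈ taylorWeights p, w' < w → ∀ h, weightPart f E B w' h = 0 := by
    intro w' hw' hlt h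
    by_contra hne
    exact absurd hlt (not_lt.2 (hmin ⟨hw', hlt.trans hw, h, hne⟩ hlt.le))
  -- Divide f by t^w: the remainder o(t) is negligible since w < 1, lower parts vanish by
  -- minimality, higher ones tend to 0. The part of weight w is therefore a limit of nonnegative
  -- numbers.
  have hpos : ∀ h, 0 ≤ weightPart f E B w h := by
    intro h
    have hpair : Tendsto (fun t : ℝ => (t, h)) (𝓝[>] 0) (𝓝[>] 0 ×ˢ 𝓝 h) :=
      tendsto_id.prodMk tendsto_const_nhds
    have h1 := (tendsto_rescaled_remainder hf horth hp hB hα h).comp hpair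
    have hrpow : ∀ s : ℝ, 0 < s → Tendsto (fun t : ℝ => t ^ s) (𝓝[>] 0) (𝓝 0) := by
      intro s hs
      have := (Real.continuousAt_rpow_const 0 s (Or.inr hs.le)).tendsto
      rw [Real.zero_rpow hs.ne'] at this
      exact this.mono_left nhdsWithin_le_nhds
    have h2 : Tendsto (fun t : ℝ => ∑ w' ∈ taylorWeights p,
        t ^ ((w' : ℝ) - w) * weightPart f E B w' h) (𝓝[>] 0)
        (𝓝 (∑ w' ∈ taylorWeights p, if w' = w then weightPart f E B w h else 0)) := by
      refine tendsto_finsetSum _ fun w' hw' => ?_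
      rcases lt_trichotomy w' w with hlt | heq | hgt
      · simp [hlow w' hw' hlt, hlt.ne]
      · subst heq; simp
      · rw [if_neg hgt.ne']
        have : (0 : ℝ) < (w' : ℝ) - w := sub_pos.2 (by exact_mod_cast hgt)
        simpa using (hrpow _ this).mul_const (weightPart f E B w' h)
    rw [Finset.sum_ite_eq' , if_pos hwT] at h2
    have hw1 : (0 : ℝ) < 1 - w := sub_pos.2 (by exact_mod_cast hw)
    have h3 := (h1.mul (hrpow _ hw1)).add h2
    rw [zero_mul, zero_add] at h3
    refine ge_of_tendsto h3 ?_
    filter_upwards [self_mem_nhdsWithin] with t ht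
    have ht : 0 < t := ht
    simp only [Function.comp_apply, Real.rpow_sub ht, Real.rpow_one]
    have hsum : ∑ w' ∈ taylorWeights p, t ^ (w' : ℝ) / t ^ (w : ℝ) * weightPart f E B w' h =
        (∑ w' ∈ taylorWeights p, t ^ (w' : ℝ) * weightPart f E B w' h) / t ^ (w : ℝ) := by
      rw [Finset.sum_div]
      exact Finset.sum_congr rfl fun _ _ => by ring
    have htw : 0 < t ^ (w : ℝ) := Real.rpow_pos_of_pos ht _
    rw [hsum]
    have : (f (B (elemMul (powVec t α) h)) -
        ∑ w' ∈ taylorWeights p, t ^ (w' : ℝ) * weightPart f E B w' h) / t * (t / t ^ (w : ℝ)) +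
        (∑ w' ∈ taylorWeights p, t ^ (w' : ℝ) * weightPart f E B w' h) / t ^ (w : ℝ) =
        f (B (elemMul (powVec t α) h)) / t ^ (w : ℝ) := by
      field_simp
      ring
    rw [this]
    exact div_nonneg (hnonneg _) htw.le
  -- Nonnegative terms with zero sum all vanish; the choice of all signs positive returns h itself.
  have hsum := (Finset.sum_eq_zero_iff_of_nonneg (fun _ _ => hpos _)).1
    (sum_sign_weightPart horth hB heven hw h) (fun _ => true) (mem_univ _)
  refine hne (Eq.trans ?_ hsum)
  congr 1
  ext i
  simp [elemMul]

/-- Joint convergence of the rescaled function to the limit function. -/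
theorem tendsto_rescaled_prod (hf : ContDiff ℝ ((2 * p : ℕ) : WithTop ℕ∞) f)
    (hnonneg : ∀ x, 0 ≤ f x) (horth : ∀ j l, j ≠ l → E j ⟂ E l) (hp : p ≠ 0)
    (hB : ∀ i, B (EuclideanSpace.single i 1) ∈ E (b i)) (heven : EvenCrossTermsVanish f 0 E)
    {α : Fin d → ℝ} (hα : ∀ i, α i = 1 / (2 * ((b i : ℕ) + 1) : ℝ)) (h₀ : Rd d) :
    Tendsto (fun q : ℝ × Rd d => f (B (elemMul (powVec q.1 α) q.2)) / q.1)
      (𝓝[>] 0 ×ˢ 𝓝 h₀) (𝓝 (limitFun f 0 E B h₀)) := by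
  have h2 : Tendsto (fun q : ℝ × Rd d => ∑ w ∈ taylorWeights p,
      q.1 ^ ((w : ℝ) - 1) * weightPart f E B w q.2) (𝓝[>] 0 ×ˢ 𝓝 h₀)
      (𝓝 (∑ w ∈ taylorWeights p, if w = 1 then weightPart f E B 1 h₀ else 0)) := by
    refine tendsto_finsetSum _ fun w hw' => ?_
    have hsnd : Tendsto (fun q : ℝ × Rd d => weightPart f E B w q.2) (𝓝[>] (0 : ℝ) ×ˢ 𝓝 h₀)
        (𝓝 (weightPart f E B w h₀)) := ((continuous_weightPart w).tendsto h₀).comp tendsto_snd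
    rcases lt_trichotomy w 1 with hlt | rfl | hgt
    · simp [weightPart_eq_zero hf hnonneg horth hp hB heven hlt, hlt.ne]
    · simpa using hsnd
    · rw [if_neg hgt.ne']
      have hs : (0 : ℝ) < (w : ℝ) - 1 := sub_pos.2 (by exact_mod_cast hgt)
      have h3 := (Real.continuousAt_rpow_const 0 ((w : ℝ) - 1) (Or.inr hs.le)).tendsto.comp
        ((tendsto_fst (f := 𝓝[>] (0 : ℝ)) (g := 𝓝 h₀)).mono_right nhdsWithin_le_nhds)
      rw [Real.zero_rpow hs.ne'] at h3
      simpa using h3.mul hsnd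
  rw [Finset.sum_ite_eq', if_pos (by simp [taylorWeights]), ← limitFun_eq_weightPart] at h2
  have h3 := (tendsto_rescaled_remainder hf horth hp hB hα h₀).add h2
  rw [zero_add] at h3
  refine h3.congr' ?_
  filter_upwards [tendsto_fst.eventually (self_mem_nhdsWithin (a := (0 : ℝ)) (s := Set.Ioi 0))]
    with q hq
  have hq : 0 < q.1 := hq
  have hsum : ∑ w ∈ taylorWeights p, q.1 ^ ((w : ℝ) - 1) * weightPart f E B w q.2 =
      (∑ w ∈ taylorWeights p, q.1 ^ (w : ℝ) * weightPart f E B w q.2) / q.1 := by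
    rw [Finset.sum_div]
    refine Finset.sum_congr rfl fun _ _ => ?_
    rw [Real.rpow_sub hq, Real.rpow_one]; ring
  rw [hsum]
  ring

end Expansion

/-! ### The limit function depends on every variable -/

section Nonconstant

open Finset

variable {d p : ℕ} {f : Rd d → ℝ} {E : Fin p → Submodule ℝ (Rd d)} {B : Rd d ≃ₗᵢ[ℝ] Rd d}

theorem iteratedFDeriv_const_congr {k n : ℕ} (h : k = n) (x u : Rd d) :
    iteratedFDeriv ℝ k f x (fun _ => u) = iteratedFDeriv ℝ n f x (fun _ => u) := by
  subst h; rfl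

/-- With a single nonzero component only pure powers of block j survive, and weight 1 fixes the
exponent to 2j+2. -/
theorem limitFun_of_mem (horth : ∀ j l, j ≠ l → E j ⟂ E l) {j : Fin p} {u : Rd d} (hu : u ∈ E j) :
    limitFun f 0 E B (B.symm u) = (1 / ((2 * (j : ℕ) + 2).factorial : ℝ)) *
      iteratedFDeriv ℝ (2 * j + 2) f 0 (fun _ => u) := by
  have hcomp : components E (B (B.symm u)) = Pi.single j u := by
    funext l
    rw [B.apply_symm_apply, components]
    by_cases hl : l = j
    · subst hl
      rw [Pi.single_eq_same, Submodule.starProjection_eq_self_iff.2 hu]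
    · rw [Pi.single_eq_of_ne hl, (E l).starProjection_apply_eq_zero_iff.2]
      exact horth _ _ (Ne.symm hl) hu
  have hsum : ∑ l, (Pi.single j (2 * (j : ℕ) + 2) : Fin p → ℕ) l = 2 * j + 2 := by simp
  have hj0 : (2 : ℚ) * ((j : ℕ) + 1) ≠ 0 := by positivity
  rw [limitFun_eq_weightPart, weightPart, Finset.sum_eq_single (Pi.single j (2 * (j : ℕ) + 2))]
  · rw [blockTerm, hcomp, hsum, Nat.multinomial_single, Nat.cast_one, one_mul, mixedTerm,
      ← iteratedFDeriv_const_congr hsum]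
    congr 2
    funext m
    have hm : (finSigmaFinEquiv.symm m).1 = j := by
      by_contra hne
      have h1 := Fin.pos (finSigmaFinEquiv.symm m).2
      rw [Pi.single_eq_of_ne hne] at h1
      exact lt_irrefl _ h1
    rw [hm, Pi.single_eq_same]
  · intro i hi hne
    have hiw := (Finset.mem_filter.1 hi).2
    have hex : ∃ l, l ≠ j ∧ 0 < i l := by
      by_contra! hall
      refine hne (funext fun l => ?_)
      by_cases hl : l = j
      · subst hl
        rw [weight, Finset.sum_eq_single l (fun k _ hk => by simp [Nat.le_zero.1 (hall k hk)])
          (by simp), div_eq_one_iff_eq hj0] at hiw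
        rw [Pi.single_eq_same]
        have : ((i l : ℕ) : ℚ) = ((2 * (l : ℕ) + 2 : ℕ) : ℚ) := by rw [hiw]; push_cast; ring
        exact_mod_cast this
      · rw [Pi.single_eq_of_ne hl]; exact Nat.le_zero.1 (hall l hl)
    obtain ⟨l, hl, hil⟩ := hex
    rw [blockTerm, mixedTerm, ContinuousMultilinearMap.map_coord_zero _
      (finSigmaFinEquiv ⟨l, ⟨0, hil⟩⟩), mul_zero, mul_zero]
    rw [hcomp, Equiv.symm_apply_apply, Pi.single_eq_of_ne hl]
  · intro hmem
    refine absurd (Finset.mem_filter.2 ⟨mem_taylorIndices.2 ?_, ?_⟩) hmem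
    · rw [hsum]; have := j.2; omega
    · rw [weight, Finset.sum_eq_single j (fun k _ hk => by simp [Pi.single_eq_of_ne hk]) (by simp),
        Pi.single_eq_same, div_eq_one_iff_eq hj0]
      push_cast; ring

/-- If `s ↦ D (u + s e)^n` is constant then `D (e, u, …, u) = 0`, for symmetric `D`. -/
theorem ContinuousMultilinearMap.update_eq_zero_of_diagonal_const {V : Type*}
    [NormedAddCommGroup V] [NormedSpace ℝ V] {n : ℕ} (D : V [×(n + 1)]→L[ℝ] ℝ)
    (hsymm : ∀ (σ : Equiv.Perm (Fin (n + 1))) v, D (v ∘ σ) = D v) (u e : V)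
    (hconst : ∀ s : ℝ, D (fun _ => u + s • e) = D (fun _ => u)) :
    D (Function.update (fun _ => u) 0 e) = 0 := by
  have h1 : HasDerivAt (fun s : ℝ => D (fun _ => u + s • e))
      (D.linearDeriv (fun _ => u) (fun _ => e)) 0 := by
    have hline : HasDerivAt (fun s : ℝ => fun _ : Fin (n + 1) => u + s • e) (fun _ => e) 0 := by
      refine hasDerivAt_pi.2 fun _ => ?_
      simpa using ((hasDerivAt_id (0 : ℝ)).smul_const e).const_add u
    have hD : HasFDerivAt D (D.linearDeriv (fun _ => u))
        (fun _ : Fin (n + 1) => u + (0 : ℝ) • e) := by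
      simpa using D.hasFDerivAt (fun _ => u)
    exact hD.comp_hasDerivAt (0 : ℝ) hline
  simp only [hconst] at h1
  have h2 := h1.unique (hasDerivAt_const (0 : ℝ) _)
  rw [ContinuousMultilinearMap.linearDeriv_apply] at h2
  -- The derivative in s is a sum over the slots that receive e; by symmetry all n+1 summands agree.
  have h3 : ∀ m : Fin (n + 1), D (Function.update (fun _ => u) m e) =
      D (Function.update (fun _ => u) 0 e) := by
    intro m
    rw [← hsymm (Equiv.swap 0 m) (Function.update (fun _ => u) 0 e)]
    congr 1
    funext k
    simp only [Function.comp_apply, Function.update_apply]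
    by_cases hk : k = m
    · simp [hk]
    · rw [if_neg hk, if_neg]
      intro h0
      have h4 := congrArg (Equiv.swap 0 m) h0
      rw [Equiv.swap_apply_self, Equiv.swap_apply_left] at h4
      exact hk h4
  simp only [h3, Finset.sum_const, Finset.card_univ, Fintype.card_fin] at h2
  rw [nsmul_eq_mul, mul_eq_zero] at h2
  exact h2.resolve_left (by positivity)

/-- Testing on block j suffices: a vector of `subF f x j` differs from one of the block by some c in
`subF f x (j + 1)`, and any term with c in a slot is zero. -/
theorem mem_subF_succ_of_forall_update_eq_zero (hf : ContDiff ℝ ((2 * p : ℕ) : WithTop ℕ∞) f)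
    {x : Rd d} {j : Fin p} (hj : (j : ℕ) + 1 < p) {e : Rd d} (he : e ∈ subE f x p j)
    (h : ∀ u ∈ subE f x p j,
      iteratedFDeriv ℝ (2 * j + 2) f x (Function.update (fun _ => u) 0 e) = 0) :
    e ∈ subF f x (j + 1) := by
  refine ⟨subE_le_subF f x j he, fun h' hh' => ?_⟩
  set c := (subF f x (j + 1)).starProjection h' with hc
  have hcmem : c ∈ subF f x (j + 1) := Submodule.starProjection_apply_mem _ _
  have hcmem' : c ∈ subF f x j := subF_succ_le f x j hcmem
  have ha : h' - c ∈ subE f x p j := by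
    rw [subE, if_pos hj]
    exact ⟨Submodule.sub_starProjection_mem_orthogonal _, Submodule.sub_mem _ hh' hcmem'⟩
  -- Slot 0 is split as e + 0 so that one expansion over subsets serves all slots.
  have hsplit : Function.update (fun _ : Fin (2 * (j : ℕ) + 2) => h') 0 e =
      Function.update (fun _ => h' - c) 0 e + Function.update (fun _ => c) 0 0 := by
    funext m
    by_cases hm : m = 0
    · subst hm; simp
    · simp [hm]
  rw [hsplit, ContinuousMultilinearMap.map_add_univ, Finset.sum_eq_single univ]
  · rw [Finset.piecewise_univ]; exact h _ ha
  · intro s _ hs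
    obtain ⟨m, hm⟩ : ∃ m, m ∉ s := by
      by_contra! hall
      exact hs (Finset.eq_univ_of_forall hall)
    by_cases hm0 : m = 0
    · subst hm0
      refine ContinuousMultilinearMap.map_coord_zero _ 0 ?_
      simp [hm]
    · refine iteratedFDeriv_eq_zero_of_mem_subF hf rfl
        (by exact_mod_cast (by omega : 2 * (j : ℕ) + 2 ≤ 2 * p)) (fun k => ?_) (m₀ := m) ?_
      · by_cases hk : k ∈ s
        · by_cases hk0 : k = 0
          · subst hk0
            simpa [hk] using subE_le_subF f x j he
          · simpa [hk, hk0] using subE_le_subF f x j ha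
        · by_cases hk0 : k = 0
          · subst hk0
            simp [hk]
          · simpa [hk, hk0] using hcmem'
      · simpa [hm, hm0] using hcmem
  · simp

theorem iteratedFDeriv_two_mul_eq_zero_of_mem_subF {q k : ℕ} {x e : Rd d} (he : e ∈ subF f x q)
    (hk : 1 ≤ k) (hkq : k ≤ q) : iteratedFDeriv ℝ (2 * k) f x (fun _ => e) = 0 := by
  obtain ⟨k, rfl⟩ := Nat.exists_eq_add_of_le' hk
  have h1 := subF_antitone f x hkq he
  have h2 := h1.2 e h1.1
  rw [Function.update_eq_self_iff.2 rfl] at h2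
  exact h2

/-- A direction of `F_{p-1}` along which the derivative of order `2p` vanishes contradicts the
positivity of the Taylor polynomial. -/
theorem iteratedFDeriv_ne_zero_of_taylorPositive {x e : Rd d} (hpos : TaylorPositive f x p)
    (he0 : e ≠ 0) (he : e ∈ subF f x (p - 1)) :
    iteratedFDeriv ℝ (2 * p) f x (fun _ => e) ≠ 0 := by
  intro hzero
  obtain ⟨r, hr, hpos⟩ := hpos
  have hen : 0 < ‖e‖ := norm_pos_iff.2 he0
  set s : ℝ := r / (2 * ‖e‖) with hs
  have hspos : 0 < s := by positivity
  have hsn : ‖s • e‖ < r := by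
    rw [norm_smul, Real.norm_eq_abs, abs_of_pos hspos, hs]
    field_simp
    linarith
  have h1 := hpos (s • e) (by simpa using hsn) (smul_ne_zero hspos.ne' he0)
  -- Adding the values at ±s • e cancels the odd degrees, while the even ones vanish along e.
  have h2 := hpos (-(s • e)) (by simpa using hsn) (neg_ne_zero.2 (smul_ne_zero hspos.ne' he0))
  have h3 := add_pos h1 h2
  rw [← Finset.sum_add_distrib] at h3
  refine h3.ne' (Finset.sum_eq_zero fun k hk => ?_)
  have hsm : ∀ c : ℝ, iteratedFDeriv ℝ k f x (fun _ => c • e) =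
      c ^ k * iteratedFDeriv ℝ k f x (fun _ => e) := by
    intro c
    rw [ContinuousMultilinearMap.map_smul_univ (c := fun _ => c) (m := fun _ => e)]
    simp
  rw [← neg_smul, hsm, hsm]
  simp only [mem_Icc] at hk
  rcases Nat.even_or_odd' k with ⟨a, rfl | rfl⟩
  · have h0 : iteratedFDeriv ℝ (2 * a) f x (fun _ => e) = 0 := by
      by_cases hap : a = p
      · rw [hap, hzero]
      · exact iteratedFDeriv_two_mul_eq_zero_of_mem_subF he (by omega) (by omega)
    rw [h0]; ring
  · rw [Odd.neg_pow ⟨a, rfl⟩]; ring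

theorem nonconstantInEachVariable_limitFun (hf : ContDiff ℝ ((2 * p : ℕ) : WithTop ℕ∞) f)
    (hpos : TaylorPositive f 0 p) {b : Fin d → Fin p}
    (hB : ∀ i, B (EuclideanSpace.single i 1) ∈ subE f 0 p (b i)) :
    NonconstantInEachVariable (limitFun f 0 (subE f 0 p) B) := by
  intro i
  by_contra! hcon
  have horth : ∀ j l, j ≠ l → subE f 0 p j ⟂ subE f 0 p l := fun j l => subE_isOrtho f 0
  set j := b i with hj
  set e := B (EuclideanSpace.single i 1) with he
  have hemem : e ∈ subE f 0 p j := hB i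
  have he0 : e ≠ 0 := by
    rw [← norm_ne_zero_iff, he, B.norm_map]
    simp
  have hconst : ∀ u ∈ subE f 0 p j, ∀ s : ℝ,
      iteratedFDeriv ℝ (2 * j + 2) f 0 (fun _ => u + s • e) =
        iteratedFDeriv ℝ (2 * j + 2) f 0 (fun _ => u) := by
    intro u hu s
    have h1 := hcon (B.symm (u + s • e)) (B.symm u) fun k hk => by simp [he, hk]
    rw [limitFun_of_mem horth hu,
      limitFun_of_mem horth (Submodule.add_mem _ hu (Submodule.smul_mem _ s hemem))] at h1
    refine mul_left_cancel₀ ?_ h1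
    positivity
  by_cases hjp : (j : ℕ) + 1 < p
  · have h1 : e ∈ subF f 0 (j + 1) := by
      refine mem_subF_succ_of_forall_update_eq_zero hf hjp hemem fun u hu => ?_
      refine ContinuousMultilinearMap.update_eq_zero_of_diagonal_const (n := 2 * (j : ℕ) + 1) _
        (fun σ v => ?_) u e (hconst u hu)
      exact hf.iteratedFDeriv_comp_perm' (n := 2 * (j : ℕ) + 2)
        (by exact_mod_cast (by omega : 2 * (j : ℕ) + 2 ≤ 2 * p)) σ 0 v
    have h2 : e ∈ (subF f 0 (j + 1))ᗮ := by
      rw [subE, if_pos hjp] at hemem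
      exact hemem.1
    exact he0 ((Submodule.mem_bot ℝ).1 ((Submodule.orthogonal_disjoint _).le_bot ⟨h1, h2⟩))
  · have hjeq : (j : ℕ) = p - 1 := by have := j.2; omega
    refine iteratedFDeriv_ne_zero_of_taylorPositive hpos he0 (hjeq ▸ subE_le_subF f 0 j hemem) ?_
    have h1 := hconst 0 (Submodule.zero_mem _) 1
    rw [zero_add, one_smul] at h1
    rw [← iteratedFDeriv_const_congr (by have := j.2; omega : 2 * (j : ℕ) + 2 = 2 * p), h1]
    exact ContinuousMultilinearMap.map_coord_zero _ 0 rfl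

end Nonconstant

/-! ### Diagonal changes of variables -/

section DiagonalScaling

variable {d : ℕ}

/-- Element-wise multiplication by a vector with nonzero coordinates. -/
noncomputable def elemMulEquiv (a : Rd d) (ha : ∀ i, a i ≠ 0) : Rd d ≃L[ℝ] Rd d :=
  LinearEquiv.toContinuousLinearEquiv
    { toFun := elemMul a
      invFun := elemMul (WithLp.toLp 2 fun i => (a i)⁻¹)
      map_add' := fun x y => by ext i; simp [elemMul, mul_add]
      map_smul' := fun c x => by ext i; simp [elemMul]; ring
      left_inv := fun x => by ext i; simp [elemMul, ha i]
      right_inv := fun x => by ext i; simp [elemMul, ha i] }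

@[simp] theorem elemMulEquiv_apply (a : Rd d) (ha : ∀ i, a i ≠ 0) (x : Rd d) :
    elemMulEquiv a ha x = elemMul a x := rfl

theorem det_elemMulEquiv (a : Rd d) (ha : ∀ i, a i ≠ 0) :
    LinearMap.det ((elemMulEquiv a ha : Rd d ≃L[ℝ] Rd d) : Rd d →ₗ[ℝ] Rd d) = ∏ i, a i := by
  rw [← LinearMap.det_toMatrix (EuclideanSpace.basisFun (Fin d) ℝ).toBasis, ← Matrix.det_diagonal]
  congr 1
  ext i j
  rw [LinearMap.toMatrix_apply, Matrix.diagonal_apply]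
  simp [elemMul]

theorem map_elemMulEquiv_volume (a : Rd d) (ha : ∀ i, a i ≠ 0) :
    Measure.map (elemMulEquiv a ha) (volume : Measure (Rd d)) =
      ENNReal.ofReal |(∏ i, a i)⁻¹| • volume := by
  rw [← det_elemMulEquiv a ha]
  refine Measure.map_linearMap_addHaar_eq_smul_addHaar volume
    (f := (elemMulEquiv a ha : Rd d →ₗ[ℝ] Rd d)) ?_
  rw [det_elemMulEquiv]
  exact Finset.prod_ne_zero_iff.2 fun i _ => ha i

theorem integral_comp_elemMul (a : Rd d) (ha : ∀ i, a i ≠ 0) (ψ : Rd d → ℝ) :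
    ∫ h, ψ (elemMul a h) = |(∏ i, a i)⁻¹| * ∫ x, ψ x := by
  have h1 := (elemMulEquiv a ha).toHomeomorph.measurableEmbedding.integral_map
    (μ := (volume : Measure (Rd d))) ψ
  have h2 : Measure.map (elemMulEquiv a ha).toHomeomorph (volume : Measure (Rd d)) =
      ENNReal.ofReal |(∏ i, a i)⁻¹| • volume := map_elemMulEquiv_volume a ha
  rw [h2, integral_smul_measure, ENNReal.toReal_ofReal (abs_nonneg _), smul_eq_mul] at h1
  exact h1.symm

theorem integrable_comp_elemMul (a : Rd d) (ha : ∀ i, a i ≠ 0) {ψ : Rd d → ℝ}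
    (hψ : Integrable ψ) : Integrable fun h => ψ (elemMul a h) := by
  have h2 : Measure.map (elemMulEquiv a ha).toHomeomorph (volume : Measure (Rd d)) =
      ENNReal.ofReal |(∏ i, a i)⁻¹| • volume := map_elemMulEquiv_volume a ha
  refine ((elemMulEquiv a ha).toHomeomorph.measurableEmbedding.integrable_map_iff
    (μ := (volume : Measure (Rd d)))).1 ?_
  rw [h2]
  exact hψ.smul_measure ENNReal.ofReal_ne_top

theorem powVec_ne_zero {t : ℝ} (ht : 0 < t) (α : Fin d → ℝ) (i : Fin d) : powVec t α i ≠ 0 :=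
  (Real.rpow_pos_of_pos ht _).ne'

theorem elemMul_powVec_invPowVec {t : ℝ} (ht : 0 < t) (α : Fin d → ℝ) (x : Rd d) :
    elemMul (powVec t α) (elemMul (invPowVec t α) x) = x := by
  ext i
  have := (Real.rpow_pos_of_pos ht (α i)).ne'
  simp [elemMul, powVec, invPowVec]
  field_simp

theorem elemMul_invPowVec_powVec {t : ℝ} (ht : 0 < t) (α : Fin d → ℝ) (x : Rd d) :
    elemMul (invPowVec t α) (elemMul (powVec t α) x) = x := by
  ext i
  have := (Real.rpow_pos_of_pos ht (α i)).ne'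
  simp [elemMul, powVec, invPowVec]
  field_simp

theorem continuous_elemMul (a : Rd d) : Continuous (elemMul a) := by
  unfold elemMul
  fun_prop

end DiagonalScaling

/-! ### Quasi-homogeneous functions and Laplace asymptotics -/

section QuasiHomogeneous

variable {d : ℕ}

/-- The quasi-homogeneous gauge `∑ h_i ^ (2 m_i)`. -/
def evenGauge (m : Fin d → ℕ) (h : Rd d) : ℝ := ∑ i, h i ^ (2 * m i)

variable {m : Fin d → ℕ} {α : Fin d → ℝ} {F G : Rd d → ℝ}

theorem continuous_evenGauge : Continuous (evenGauge m) := by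
  unfold evenGauge
  fun_prop

theorem evenGauge_nonneg (h : Rd d) : 0 ≤ evenGauge m h :=
  Finset.sum_nonneg fun _ _ => (even_two_mul _).pow_nonneg _

theorem evenGauge_powVec (hm : ∀ i, 1 ≤ m i) (hα : ∀ i, α i = 1 / (2 * m i : ℝ)) {t : ℝ}
    (ht : 0 < t) (h : Rd d) : evenGauge m (elemMul (powVec t α) h) = t * evenGauge m h := by
  rw [evenGauge, evenGauge, Finset.mul_sum]
  refine Finset.sum_congr rfl fun i _ => ?_
  have h1 : (powVec t α i) ^ (2 * m i) = t := by
    have h2 : (m i : ℝ) ≠ 0 := by have := hm i; positivity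
    change (t ^ α i) ^ (2 * m i) = t
    rw [← Real.rpow_mul_natCast ht.le, hα]
    have : 1 / (2 * m i : ℝ) * ((2 * m i : ℕ) : ℝ) = 1 := by push_cast; field_simp
    rw [this, Real.rpow_one]
  change (powVec t α i * h i) ^ (2 * m i) = _
  rw [mul_pow, h1]

/-- Coordinatewise x² ≤ x^(2m) + 1. This makes the gauge sphere compact and e^(-c·gauge)
Gaussian-dominated. -/
theorem sq_norm_le_evenGauge_add (hm : ∀ i, 1 ≤ m i) (h : Rd d) : ‖h‖ ^ 2 ≤ evenGauge m h + d := by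
  rw [EuclideanSpace.norm_sq_eq, evenGauge]
  have : (d : ℝ) = ∑ _i : Fin d, (1 : ℝ) := by simp
  rw [this, ← Finset.sum_add_distrib]
  refine Finset.sum_le_sum fun i _ => ?_
  rw [Real.norm_eq_abs, sq_abs, pow_mul]
  rcases le_total (h i ^ 2) 1 with h1 | h1
  · have := pow_nonneg (sq_nonneg (h i)) (m i)
    linarith
  · have := le_self_pow₀ h1 (by have := hm i; omega : m i ≠ 0)
    linarith

theorem evenGauge_pos {h : Rd d} (hh : h ≠ 0) : 0 < evenGauge m h := by
  refine lt_of_le_of_ne (evenGauge_nonneg h) fun h0 => hh ?_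
  have h1 := (Finset.sum_eq_zero_iff_of_nonneg
    (fun i _ => (even_two_mul (m i)).pow_nonneg (h i))).1 h0.symm
  ext i
  exact eq_zero_of_pow_eq_zero (h1 i (Finset.mem_univ i))

theorem isCompact_evenGauge_eq_one (hm : ∀ i, 1 ≤ m i) :
    IsCompact {h : Rd d | evenGauge m h = 1} := by
  refine Metric.isCompact_of_isClosed_isBounded
    (isClosed_eq continuous_evenGauge continuous_const) ?_
  refine (Metric.isBounded_closedBall (x := (0 : Rd d)) (r := 1 + d)).subset fun h hh => ?_
  have h1 := sq_norm_le_evenGauge_add hm h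
  rw [show evenGauge m h = 1 from hh] at h1
  rw [mem_closedBall_zero_iff]
  have : (0 : ℝ) ≤ d := by positivity
  nlinarith [norm_nonneg h]

theorem exists_evenGauge_eq_one (hm : ∀ i, 1 ≤ m i) (hα : ∀ i, α i = 1 / (2 * m i : ℝ)) {h : Rd d}
    (hh : h ≠ 0) : ∃ u, evenGauge m u = 1 ∧ elemMul (powVec (evenGauge m h) α) u = h := by
  have hpos := evenGauge_pos (m := m) hh
  refine ⟨elemMul (invPowVec (evenGauge m h) α) h, ?_, elemMul_powVec_invPowVec hpos α h⟩
  have h1 := evenGauge_powVec hm hα hpos (elemMul (invPowVec (evenGauge m h) α) h)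
  rw [elemMul_powVec_invPowVec hpos] at h1
  exact (mul_left_cancel₀ hpos.ne' (by rw [← h1, mul_one]))

/-- The orbit t^α * h escapes to infinity, where G must become positive, but along it G equals t
G(h). -/
theorem pos_of_coercive (hα : ∀ i, 0 < α i) (hG : Coercive G)
    (hhom : ∀ t, 0 < t → ∀ h, G (elemMul (powVec t α) h) = t * G h) {h : Rd d} (hh : h ≠ 0) :
    0 < G h := by
  by_contra! hle
  obtain ⟨i, hi⟩ : ∃ i, h i ≠ 0 := by
    by_contra! hall
    exact hh (by ext i; exact hall i)
  have h1 : Tendsto (fun t : ℝ => elemMul (powVec t α) h) atTop (Bornology.cobounded (Rd d)) := by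
    rw [← tendsto_norm_atTop_iff_cobounded]
    refine tendsto_atTop_mono' atTop ?_
      ((tendsto_rpow_atTop (hα i)).atTop_mul_const (abs_pos.2 hi))
    filter_upwards [eventually_gt_atTop 0] with t ht
    refine le_trans (le_of_eq ?_) (PiLp.norm_apply_le (elemMul (powVec t α) h) i)
    simp [elemMul, powVec, abs_of_pos (Real.rpow_pos_of_pos ht (α i))]
  have h2 := (hG.comp h1).eventually (eventually_gt_atTop 0)
  obtain ⟨t, ht, ht'⟩ := (h2.and (eventually_gt_atTop 0)).exists
  simp only [Function.comp_apply, hhom t ht'] at ht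
  exact absurd ht (not_lt.2 (mul_nonpos_of_nonneg_of_nonpos ht'.le hle))

/-- G has a positive minimum on the compact gauge sphere, and homogeneity carries the bound along
the orbits. -/
theorem exists_evenGauge_le (hm : ∀ i, 1 ≤ m i) (hα : ∀ i, α i = 1 / (2 * m i : ℝ))
    (hGc : Continuous G) (hG : Coercive G)
    (hhom : ∀ t, 0 < t → ∀ h, G (elemMul (powVec t α) h) = t * G h) :
    ∃ c > 0, (∀ u, evenGauge m u = 1 → c ≤ G u) ∧ ∀ h, c * evenGauge m h ≤ G h := by
  have hαpos : ∀ i, 0 < α i := fun i => by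
    rw [hα]; have := hm i; positivity
  obtain ⟨c, hc, hS⟩ : ∃ c > 0, ∀ u, evenGauge m u = 1 → c ≤ G u := by
    -- The sphere is empty when d = 0.
    rcases Set.eq_empty_or_nonempty {h : Rd d | evenGauge m h = 1} with hemp | hne
    · exact ⟨1, one_pos, fun u hu =>
        absurd (show u ∈ {h | evenGauge m h = 1} from hu) (by simp [hemp])⟩
    · obtain ⟨u, hu, hmin⟩ := (isCompact_evenGauge_eq_one hm).exists_isMinOn hne hGc.continuousOn
      refine ⟨G u, pos_of_coercive hαpos hG hhom ?_, fun v hv => hmin hv⟩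
      rintro rfl
      have h0 : evenGauge m (0 : Rd d) = 0 :=
        Finset.sum_eq_zero fun i _ => zero_pow (by have := hm i; omega)
      rw [Set.mem_ofPred_eq, h0] at hu
      exact zero_ne_one hu
  refine ⟨c, hc, hS, fun h => ?_⟩
  by_cases hh : h = 0
  · subst hh
    have h0 : evenGauge m (0 : Rd d) = 0 :=
      Finset.sum_eq_zero fun i _ => zero_pow (by have := hm i; omega)
    have h1 := hhom 2 two_pos 0
    have h2 : elemMul (powVec 2 α) 0 = 0 := by ext i; simp [elemMul]
    rw [h2] at h1
    rw [h0]; linarith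
  · obtain ⟨u, hu, huh⟩ := exists_evenGauge_eq_one hm hα hh
    have h1 := hhom _ (evenGauge_pos (m := m) hh) u
    rw [huh] at h1
    rw [h1, mul_comm]
    exact mul_le_mul_of_nonneg_left (hS u hu) (evenGauge_nonneg h)

theorem integrable_exp_neg_evenGauge (hm : ∀ i, 1 ≤ m i) {c : ℝ} (hc : 0 < c) :
    Integrable fun h => Real.exp (-(c * evenGauge m h)) := by
  have h1 : Integrable fun h : Rd d => Real.exp (c * d) * Real.exp (-c * ‖h‖ ^ 2) := by
    have h2 := (GaussianFourier.integrable_cexp_neg_mul_sq_norm_add (V := Rd d) (b := (c : ℂ))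
      (by simpa) 0 0).norm
    refine (h2.congr (Eventually.of_forall fun h => ?_)).const_mul _
    simp [Complex.norm_exp, ← Complex.ofReal_pow]
  refine h1.mono' (by have := continuous_evenGauge (m := m); fun_prop)
    (Eventually.of_forall fun h => ?_)
  rw [Real.norm_eq_abs, Real.abs_exp, ← Real.exp_add]
  have := mul_le_mul_of_nonneg_left (sq_norm_le_evenGauge_add hm h) hc.le
  exact Real.exp_le_exp.2 (by linarith)

theorem integrable_exp_neg_of_coercive (hm : ∀ i, 1 ≤ m i) (hα : ∀ i, α i = 1 / (2 * m i : ℝ))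
    (hGc : Continuous G) (hG : Coercive G)
    (hhom : ∀ t, 0 < t → ∀ h, G (elemMul (powVec t α) h) = t * G h) :
    Integrable fun h => Real.exp (-G h) := by
  obtain ⟨c, hc, -, hle⟩ := exists_evenGauge_le hm hα hGc hG hhom
  refine (integrable_exp_neg_evenGauge hm hc).mono' (by fun_prop) (Eventually.of_forall fun h => ?_)
  rw [Real.norm_eq_abs, Real.abs_exp]
  exact Real.exp_le_exp.2 (neg_le_neg (hle h))

/-- Joint convergence in (t, u) and compactness of the gauge sphere give one threshold valid for all
u; then write x = t^α * u with t the gauge of x. -/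
theorem exists_evenGauge_le_of_tendsto (hm : ∀ i, 1 ≤ m i) (hα : ∀ i, α i = 1 / (2 * m i : ℝ))
    (hF : ∀ x, 0 ≤ F x)
    (hlim : ∀ h₀, Tendsto (fun q : ℝ × Rd d => F (elemMul (powVec q.1 α) q.2) / q.1)
      (𝓝[>] 0 ×ˢ 𝓝 h₀) (𝓝 (G h₀)))
    {c : ℝ} (hc : 0 < c) (hS : ∀ u, evenGauge m u = 1 → c ≤ G u) :
    ∃ t₀ > 0, ∀ x, evenGauge m x ≤ t₀ → c / 2 * evenGauge m x ≤ F x := by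
  have h1 : ∀ᶠ t : ℝ in 𝓝 0, ∀ u ∈ {h : Rd d | evenGauge m h = 1},
      0 < t → c / 2 ≤ F (elemMul (powVec t α) u) / t := by
    refine (isCompact_evenGauge_eq_one hm).eventually_forall_of_forall_eventually fun u hu => ?_
    have h2 := (hlim u).eventually (lt_mem_nhds (lt_of_lt_of_le (half_lt_self hc) (hS u hu)))
    rw [← nhdsWithin_univ u, ← nhdsWithin_prod_eq, eventually_nhdsWithin_iff] at h2
    filter_upwards [h2] with q hq hq0
    exact (hq ⟨hq0, trivial⟩).le
  obtain ⟨δ, hδ, hball⟩ := Metric.eventually_nhds_iff.1 h1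
  refine ⟨δ / 2, half_pos hδ, fun x hx => ?_⟩
  by_cases hx0 : x = 0
  · subst hx0
    have h0 : evenGauge m (0 : Rd d) = 0 :=
      Finset.sum_eq_zero fun i _ => zero_pow (by have := hm i; omega)
    rw [h0, mul_zero]; exact hF 0
  · have hpos := evenGauge_pos (m := m) hx0
    obtain ⟨u, hu, hux⟩ := exists_evenGauge_eq_one hm hα hx0
    have h3 := hball (y := evenGauge m x)
      (by rw [Real.dist_eq, sub_zero, abs_of_pos hpos]; linarith) u hu hpos
    rwa [hux, le_div_iff₀ hpos] at h3

theorem exists_le_of_lt_evenGauge (hm : ∀ i, 1 ≤ m i) (hFc : Continuous F) (hF : Coercive F)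
    (hFpos : ∀ x, x ≠ 0 → 0 < F x) {t₀ : ℝ} (ht₀ : 0 < t₀) :
    ∃ μ > 0, ∀ x, t₀ ≤ evenGauge m x → μ ≤ F x := by
  have h1 : ∀ᶠ x in Bornology.cobounded (Rd d), 1 ≤ F x := hF.eventually (eventually_ge_atTop 1)
  obtain ⟨R, hR⟩ : ∃ R, ∀ x : Rd d, R < ‖x‖ → 1 ≤ F x := by
    rw [← comap_norm_atTop, eventually_comap] at h1
    obtain ⟨R, hR⟩ := eventually_atTop.1 h1
    exact ⟨R, fun x hx => hR _ hx.le x rfl⟩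
  have hK : IsCompact ({x : Rd d | t₀ ≤ evenGauge m x} ∩ Metric.closedBall 0 R) :=
    (isCompact_closedBall _ _).inter_left (isClosed_le continuous_const continuous_evenGauge)
  rcases Set.eq_empty_or_nonempty ({x : Rd d | t₀ ≤ evenGauge m x} ∩ Metric.closedBall 0 R) with
    hemp | hne
  · refine ⟨1, one_pos, fun x hx => hR x (not_le.1 fun hle => ?_)⟩
    exact Set.notMem_empty x (hemp ▸ ⟨hx, mem_closedBall_zero_iff.2 hle⟩)
  · obtain ⟨u, hu, hmin⟩ := hK.exists_isMinOn hne hFc.continuousOn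
    have hu0 : u ≠ 0 := by
      rintro rfl
      have h0 : evenGauge m (0 : Rd d) = 0 :=
        Finset.sum_eq_zero fun i _ => zero_pow (by have := hm i; omega)
      have := hu.1
      rw [Set.mem_ofPred_eq, h0] at this
      linarith
    refine ⟨min 1 (F u), lt_min one_pos (hFpos u hu0), fun x hx => ?_⟩
    by_cases hxR : ‖x‖ ≤ R
    · exact (min_le_right _ _).trans (hmin ⟨hx, mem_closedBall_zero_iff.2 hxR⟩)
    · exact (min_le_left _ _).trans (hR x (not_le.1 hxR))

theorem tendsto_prod_powVec_mul_exp (α : Fin d → ℝ) {μ : ℝ} (hμ : 0 < μ) :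
    Tendsto (fun t : ℝ => |(∏ i, powVec t α i)⁻¹| * Real.exp (-(1 / t - 1) * μ)) (𝓝[>] 0)
      (𝓝 0) := by
  have h1 := ((tendsto_rpow_mul_exp_neg_mul_atTop_nhds_zero (∑ i, α i) μ hμ).comp
    tendsto_inv_nhdsGT_zero).mul_const (Real.exp μ)
  rw [zero_mul] at h1
  refine h1.congr' ?_
  filter_upwards [self_mem_nhdsWithin] with t ht
  have ht : 0 < t := ht
  have h2 : ∏ i, powVec t α i = t ^ (∑ i, α i) := (Real.rpow_sum_of_pos ht _ _).symm
  rw [h2, abs_of_pos (inv_pos.2 (Real.rpow_pos_of_pos ht _)), ← Real.inv_rpow ht.le]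
  simp only [Function.comp_apply]
  rw [mul_assoc, ← Real.exp_add]
  congr 2
  field_simp
  ring

/-- Laplace asymptotics with anisotropic scaling. -/
theorem tendsto_integral_rescaled (hm : ∀ i, 1 ≤ m i) (hα : ∀ i, α i = 1 / (2 * m i : ℝ))
    (hFc : Continuous F) (hF : Coercive F) (hF0 : 0 ≤ F 0) (hFpos : ∀ x, x ≠ 0 → 0 < F x)
    (hint : Integrable fun x => Real.exp (-F x))
    (hlim : ∀ h₀, Tendsto (fun q : ℝ × Rd d => F (elemMul (powVec q.1 α) q.2) / q.1)
      (𝓝[>] 0 ×ˢ 𝓝 h₀) (𝓝 (G h₀)))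
    (hGc : Continuous G) (hG : Coercive G)
    (hhom : ∀ t, 0 < t → ∀ h, G (elemMul (powVec t α) h) = t * G h)
    {φ : Rd d → ℝ} (hφ : Continuous φ) {C : ℝ} (hC : ∀ x, |φ x| ≤ C) :
    Tendsto (fun t : ℝ => ∫ h, φ h * Real.exp (-F (elemMul (powVec t α) h) / t)) (𝓝[>] 0)
      (𝓝 (∫ h, φ h * Real.exp (-G h))) := by
  have hFnn : ∀ x, 0 ≤ F x := fun x => by
    by_cases hx : x = 0
    · rwa [hx]
    · exact (hFpos x hx).le
  have hC0 : 0 ≤ C := (abs_nonneg _).trans (hC 0)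
  obtain ⟨c, hc, hS, -⟩ := exists_evenGauge_le hm hα hGc hG hhom
  obtain ⟨t₀, ht₀, hloc⟩ := exists_evenGauge_le_of_tendsto hm hα hFnn hlim hc hS
  obtain ⟨μ, hμ, hglob⟩ := exists_le_of_lt_evenGauge hm hFc hF hFpos ht₀
  set K : ℝ → Rd d → ℝ := fun t h => φ h * Real.exp (-F (elemMul (powVec t α) h) / t) with hK
  -- By homogeneity of the gauge, the points whose rescaling lies where the local lower bound on F
  -- holds.
  set A : ℝ → Set (Rd d) := fun t => {h | t * evenGauge m h ≤ t₀} with hA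
  have hAm : ∀ t, MeasurableSet (A t) := fun t =>
    (isClosed_le (continuous_const.mul continuous_evenGauge) continuous_const).measurableSet
  have hKc : ∀ t, Continuous (K t) := fun t => by
    have h1 := hFc.comp (continuous_elemMul (powVec t α))
    exact hφ.mul (Real.continuous_exp.comp (h1.neg.div_const t))
  have hsmall : ∀ᶠ t : ℝ in 𝓝[>] 0, t ∈ Set.Ioc (0 : ℝ) 1 := Ioc_mem_nhdsGT zero_lt_one
  have hcomp : ∀ t : ℝ, 0 < t → Integrable fun h => Real.exp (-F (elemMul (powVec t α) h)) :=
    fun t ht => integrable_comp_elemMul (powVec t α) (powVec_ne_zero ht α) hint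
  have hKint : ∀ t ∈ Set.Ioc (0 : ℝ) 1, Integrable (K t) := by
    intro t ht
    refine ((hcomp t ht.1).const_mul C).mono' (hKc t).aestronglyMeasurable
      (Eventually.of_forall fun h => ?_)
    rw [Real.norm_eq_abs, abs_mul, Real.abs_exp]
    refine mul_le_mul (hC h) (Real.exp_le_exp.2 ?_) (Real.exp_pos _).le hC0
    rw [neg_div, neg_le_neg_iff, le_div_iff₀ ht.1]
    exact mul_le_of_le_one_right (hFnn _) ht.2
  have hmain : Tendsto (fun t => ∫ h, (A t).indicator (K t) h) (𝓝[>] 0)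
      (𝓝 (∫ h, φ h * Real.exp (-G h))) := by
    refine tendsto_integral_filter_of_dominated_convergence
      (fun h => C * Real.exp (-(c / 2 * evenGauge m h))) ?_ ?_ ?_ ?_
    · exact Eventually.of_forall fun t => (hKc t).aestronglyMeasurable.indicator (hAm t)
    · filter_upwards [hsmall] with t ht
      refine Eventually.of_forall fun h => ?_
      by_cases hh : h ∈ A t
      · rw [Set.indicator_of_mem hh, Real.norm_eq_abs, abs_mul, Real.abs_exp]
        refine mul_le_mul (hC h) (Real.exp_le_exp.2 ?_) (Real.exp_pos _).le hC0
        have h1 := hloc (elemMul (powVec t α) h) (by rw [evenGauge_powVec hm hα ht.1]; exact hh)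
        rw [evenGauge_powVec hm hα ht.1] at h1
        rw [neg_div, neg_le_neg_iff, le_div_iff₀ ht.1]
        linarith
      · rw [Set.indicator_of_notMem hh, norm_zero]
        positivity
    · exact (integrable_exp_neg_evenGauge hm (half_pos hc)).const_mul C
    · refine Eventually.of_forall fun h => ?_
      have hpair : Tendsto (fun t : ℝ => (t, h)) (𝓝[>] 0) (𝓝[>] 0 ×ˢ 𝓝 h) :=
        tendsto_id.prodMk tendsto_const_nhds
      have h1 := ((Real.continuous_exp.tendsto _).comp ((hlim h).comp hpair).neg).const_mul (φ h)
      refine h1.congr' ?_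
      have h2 : Tendsto (fun t : ℝ => t * evenGauge m h) (𝓝[>] 0) (𝓝 0) := by
        have : Tendsto (fun t : ℝ => t * evenGauge m h) (𝓝 0) (𝓝 (0 * evenGauge m h)) :=
          tendsto_id.mul_const _
        rw [zero_mul] at this
        exact this.mono_left nhdsWithin_le_nhds
      filter_upwards [h2.eventually (gt_mem_nhds ht₀)] with t ht
      rw [Set.indicator_of_mem (show h ∈ A t from ht.le)]
      simp only [hK, Function.comp_apply, neg_div]
  -- Here F ≥ μ, so F/t ≥ (1/t - 1)μ + F. The factor e^(-F) kept aside is integrable at the cost of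
  -- a Jacobian, a negative power of t that the exponential beats.
  have htail : Tendsto (fun t => ∫ h, (A t)ᶜ.indicator (K t) h) (𝓝[>] 0) (𝓝 0) := by
    have h1 := (tendsto_prod_powVec_mul_exp α hμ).mul_const (C * ∫ x, Real.exp (-F x))
    rw [zero_mul] at h1
    refine squeeze_zero_norm' ?_ h1
    filter_upwards [hsmall] with t ht
    have h2 : ∀ h, ‖(A t)ᶜ.indicator (K t) h‖ ≤
        C * Real.exp (-(1 / t - 1) * μ) * Real.exp (-F (elemMul (powVec t α) h)) := by
      intro h
      by_cases hh : h ∈ (A t)ᶜ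
      · rw [Set.indicator_of_mem hh, Real.norm_eq_abs, abs_mul, Real.abs_exp, mul_assoc,
          ← Real.exp_add]
        refine mul_le_mul (hC h) (Real.exp_le_exp.2 ?_) (Real.exp_pos _).le hC0
        have h3 := hglob (elemMul (powVec t α) h)
          (by rw [evenGauge_powVec hm hα ht.1]; exact (lt_of_not_ge fun hle => hh hle).le)
        have h4 : 0 ≤ 1 / t - 1 := sub_nonneg.2 (by rw [le_div_iff₀ ht.1, one_mul]; exact ht.2)
        have h5 := mul_le_mul_of_nonneg_left h3 h4
        have h6 : -F (elemMul (powVec t α) h) / t =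
          -(1 / t - 1) * F (elemMul (powVec t α) h) - F (elemMul (powVec t α) h) := by ring
        rw [h6]
        linarith
      · rw [Set.indicator_of_notMem hh, norm_zero]
        positivity
    refine (norm_integral_le_of_norm_le ((hcomp t ht.1).const_mul _)
      (Eventually.of_forall h2)).trans (le_of_eq ?_)
    rw [integral_const_mul, integral_comp_elemMul (powVec t α) (powVec_ne_zero ht.1 α)
      (fun x => Real.exp (-F x))]
    ring
  have hsum := hmain.add htail
  rw [add_zero] at hsum
  refine hsum.congr' ?_
  filter_upwards [hsmall] with t ht
  rw [← integral_add ((hKint t ht).indicator (hAm t)) ((hKint t ht).indicator (hAm t).compl)]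
  refine integral_congr_ae (Eventually.of_forall fun h => ?_)
  exact congrFun (Set.indicator_self_add_compl (A t) (K t)) h

end QuasiHomogeneous

/-! ### From Laplace integrals to convergence in law -/

section ConvergenceInLaw

variable {d : ℕ}

theorem integral_withDensity_exp {u : Rd d → ℝ} (hu : Continuous u) {z : ℝ} (hz : 0 ≤ z)
    (ψ : Rd d → ℝ) :
    ∫ x, ψ x ∂(volume.withDensity fun x => ENNReal.ofReal (z * Real.exp (u x))) =
      z * ∫ x, ψ x * Real.exp (u x) := by
  rw [integral_withDensity_eq_integral_toReal_smul (by fun_prop)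
    (Eventually.of_forall fun x => ENNReal.ofReal_lt_top), ← integral_const_mul]
  refine integral_congr_ae (Eventually.of_forall fun x => ?_)
  simp only [smul_eq_mul]
  rw [ENNReal.toReal_ofReal (by positivity)]
  ring

theorem integral_comp_isometry_elemMul (B : Rd d ≃ₗᵢ[ℝ] Rd d) {t : ℝ} (ht : 0 < t)
    (α : Fin d → ℝ) (ψ : Rd d → ℝ) :
    ∫ h, ψ (B (elemMul (powVec t α) h)) = |(∏ i, powVec t α i)⁻¹| * ∫ x, ψ x := by
  rw [integral_comp_elemMul (powVec t α) (powVec_ne_zero ht α) (fun x => ψ (B x)),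
    B.measurePreserving.integral_comp B.toHomeomorph.measurableEmbedding]

theorem coercive_comp_isometry {f : Rd d → ℝ} (hf : Coercive f) (B : Rd d ≃ₗᵢ[ℝ] Rd d) :
    Coercive fun x => f (B x) := by
  refine hf.comp ?_
  rw [← tendsto_norm_atTop_iff_cobounded]
  simpa using tendsto_norm_cobounded_atTop (E := Rd d)

universe u v

/-- Against a bounded continuous φ, the substitution x = B(t^α * h) turns the expectation into a
quotient of two Laplace integrals; the Jacobians cancel and both integrals converge. -/
theorem tendstoInDistribution_rescaled_gibbs {f G : Rd d → ℝ} {B : Rd d ≃ₗᵢ[ℝ] Rd d}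
    {m : Fin d → ℕ} {α : Fin d → ℝ} (hm : ∀ i, 1 ≤ m i) (hα : ∀ i, α i = 1 / (2 * m i : ℝ))
    (hfc : Continuous f) (hf : Coercive f) (hf0 : f 0 = 0) (hargmin : argmin f = {0})
    (hint : Integrable fun x => Real.exp (-f x))
    (hlim : ∀ h₀, Tendsto (fun q : ℝ × Rd d => f (B (elemMul (powVec q.1 α) q.2)) / q.1)
      (𝓝[>] 0 ×ˢ 𝓝 h₀) (𝓝 (G h₀)))
    (hGc : Continuous G) (hG : Coercive G)
    (hhom : ∀ t, 0 < t → ∀ h, G (elemMul (powVec t α) h) = t * G h)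
    (Ω : Set.Ioc (0 : ℝ) 1 → Type u) [∀ t, MeasurableSpace (Ω t)]
    (P : ∀ t, Measure (Ω t)) [∀ t, IsProbabilityMeasure (P t)] (X : ∀ t, Ω t → Rd d)
    (Ω' : Type v) [MeasurableSpace Ω'] (P' : Measure Ω') [IsProbabilityMeasure P'] (Y : Ω' → Rd d)
    (hX : ∀ t, HasLaw (X t) (gibbs f t) (P t)) (hY : HasLaw Y (expNegLaw G) P') :
    TendstoInDistribution
      (fun (t : Set.Ioc (0 : ℝ) 1) ω => elemMul (invPowVec t α) (B.symm (X t ω)))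
      (comap (fun t : Set.Ioc (0 : ℝ) 1 => (t : ℝ)) (𝓝 0)) Y P P' := by
  have hfpos : ∀ x, x ≠ 0 → 0 < f x := by
    intro x hx
    have h0 : (0 : Rd d) ∈ argmin f := by rw [hargmin]; rfl
    refine lt_of_le_of_ne (hf0 ▸ h0 x) fun hfx => hx ?_
    have : x ∈ argmin f := fun y => by rw [← hfx, ← hf0]; exact h0 y
    rwa [hargmin] at this
  have hmeas : ∀ t : Set.Ioc (0 : ℝ) 1, Continuous fun x =>
      elemMul (invPowVec (t : ℝ) α) (B.symm x) := fun t =>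
    (continuous_elemMul _).comp B.symm.continuous
  have hXm : ∀ t : Set.Ioc (0 : ℝ) 1,
      AEMeasurable (fun ω => elemMul (invPowVec t α) (B.symm (X t ω))) (P t) := fun t =>
    (hmeas t).measurable.comp_aemeasurable (hX t).aemeasurable
  refine ⟨hXm, hY.aemeasurable, ?_⟩
  refine ProbabilityMeasure.tendsto_iff_forall_integral_tendsto.2 fun φ => ?_
  have hB0 : B 0 = 0 := map_zero B
  have key : ∀ {ψ : Rd d → ℝ} (_ : Continuous ψ) {C : ℝ} (_ : ∀ x, |ψ x| ≤ C),
      Tendsto (fun t : ℝ => ∫ h, ψ h * Real.exp (-f (B (elemMul (powVec t α) h)) / t)) (𝓝[>] 0)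
        (𝓝 (∫ h, ψ h * Real.exp (-G h))) := fun hψ _ hC =>
    tendsto_integral_rescaled (F := fun x => f (B x)) hm hα (hfc.comp B.continuous)
      (coercive_comp_isometry hf B) (by rw [hB0, hf0])
      (fun x hx => hfpos _ (by simpa using hx))
      ((B.measurePreserving.integrable_comp_emb B.toHomeomorph.measurableEmbedding).2 hint)
      hlim hGc hG hhom hψ hC
  have h1 := key φ.continuous (fun x => φ.norm_coe_le_norm x)
  have h2 := key (ψ := fun _ => 1) continuous_const (C := 1) (fun x => by simp)
  simp only [one_mul] at h2
  have hZ : 0 < ∫ h, Real.exp (-G h) :=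
    integral_exp_pos (integrable_exp_neg_of_coercive hm hα hGc hG hhom)
  have h3 : Tendsto (fun t : Set.Ioc (0 : ℝ) 1 => (t : ℝ))
      (comap (fun t : Set.Ioc (0 : ℝ) 1 => (t : ℝ)) (𝓝 0)) (𝓝[>] 0) :=
    tendsto_nhdsWithin_iff.2 ⟨tendsto_comap, Eventually.of_forall fun t => t.2.1⟩
  have h4 := ((h2.inv₀ hZ.ne').mul h1).comp h3
  have hlimit : ∫ x, φ x ∂(P'.map Y) = (∫ h, Real.exp (-G h))⁻¹ * ∫ h, φ h * Real.exp (-G h) := by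
    rw [hY.map_eq, expNegLaw, integral_withDensity_exp (u := fun x => -G x) hGc.neg
      (inv_nonneg.2 hZ.le)]
  have hpre : ∀ t : Set.Ioc (0 : ℝ) 1,
      ∫ x, φ x ∂((P t).map fun ω => elemMul (invPowVec t α) (B.symm (X t ω))) =
        (∫ h, Real.exp (-f (B (elemMul (powVec t α) h)) / t))⁻¹ *
          ∫ h, φ h * Real.exp (-f (B (elemMul (powVec t α) h)) / t) := by
    intro t
    have ht : 0 < (t : ℝ) := t.2.1
    have e1 := integral_comp_isometry_elemMul B ht α (fun x => Real.exp (-f x / t))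
    have e2 := integral_comp_isometry_elemMul B ht α
      (fun x => φ (elemMul (invPowVec t α) (B.symm x)) * Real.exp (-f x / t))
    simp only [LinearIsometryEquiv.symm_apply_apply, elemMul_invPowVec_powVec ht] at e2
    have hJ : |(∏ i, powVec (t : ℝ) α i)⁻¹| ≠ 0 :=
      abs_ne_zero.2 (inv_ne_zero (Finset.prod_ne_zero_iff.2 fun i _ => powVec_ne_zero ht α i))
    rw [e1, e2, mul_inv, mul_mul_mul_comm, inv_mul_cancel₀ hJ, one_mul,
      integral_map (hXm t) φ.continuous.aestronglyMeasurable,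
      ← integral_map (f := fun x => φ (elemMul (invPowVec t α) (B.symm x))) (hX t).aemeasurable
        (φ.continuous.comp (hmeas t)).aestronglyMeasurable,
      (hX t).map_eq, gibbs,
      integral_withDensity_exp (u := fun x => -f x / (t : ℝ)) (hfc.neg.div_const _)]
    exact inv_nonneg.2 (integral_nonneg fun x => (Real.exp_pos _).le)
  simp only [ProbabilityMeasure.coe_mk, hlimit, hpre]
  exact h4

end ConvergenceInLaw

/-! ### Assembly of the theorem -/

/-- The exponents and the block structure needed for the convergence of the rescaled function. -/
theorem exists_block_data {d p : ℕ} {f : Rd d → ℝ}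
    (hf : ContDiff ℝ ((2 * p : ℕ) : WithTop ℕ∞) f) (hnonneg : ∀ x, 0 ≤ f x) (hf0 : f 0 = 0)
    {B : Rd d ≃ₗᵢ[ℝ] Rd d} (hB : IsAdapted (subE f 0 p) B)
    (heven : 5 ≤ p → EvenCrossTermsVanish f 0 (subE f 0 p)) (hp : p ≠ 0) :
    ∃ b : Fin d → Fin p, (∀ i, B (EuclideanSpace.single i 1) ∈ subE f 0 p (b i)) ∧
      (∀ i, exponent (subE f 0 p) i = 1 / (2 * ((b i : ℕ) + 1) : ℝ)) ∧
      (∀ h₀, Tendsto (fun q : ℝ × Rd d =>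
        f (B (elemMul (powVec q.1 (exponent (subE f 0 p))) q.2)) / q.1)
        (𝓝[>] 0 ×ˢ 𝓝 h₀) (𝓝 (limitFun f 0 (subE f 0 p) B h₀))) ∧
      ∀ t, 0 < t → ∀ h, limitFun f 0 (subE f 0 p) B
        (elemMul (powVec t (exponent (subE f 0 p))) h) = t * limitFun f 0 (subE f 0 p) B h := by
  choose b hb hb' using existsUnique_inBlock (sum_finrank_subE f 0 hp)
  have hBb : ∀ i, B (EuclideanSpace.single i 1) ∈ subE f 0 p (b i) := fun i => hB _ i (hb i)
  have hα := exponent_eq_of_inBlock (E := subE f 0 p) (b := b)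
    fun i j => ⟨fun h => (hb' i j h).symm, fun h => h ▸ hb i⟩
  have horth : ∀ j l, j ≠ l → subE f 0 p j ⟂ subE f 0 p l := fun j l => subE_isOrtho f 0
  have hev : EvenCrossTermsVanish f 0 (subE f 0 p) := by
    rcases le_or_gt 5 p with h | h
    · exact heven h
    · exact evenCrossTermsVanish_of_le_four hf hf0 (by omega)
  exact ⟨b, hBb, hα, tendsto_rescaled_prod hf hnonneg horth hp hBb hev hα,
    fun t ht h => limitFun_powVec horth hBb hα ht h⟩

theorem mainTheorem2 {d p : ℕ} (f : Rd d → ℝ)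
    (hf : ContDiff ℝ ((2 * p : ℕ) : WithTop ℕ∞) f)
    (hcoercive : Coercive f)
    (hargmin : argmin f = {0})
    (hstrict : StrictPolynomialMin p 0 f)
    (hf0 : f 0 = 0)
    (hint : Integrable (fun x => Real.exp (-f x)))
    (B : Rd d ≃ₗᵢ[ℝ] Rd d)
    (hB : IsAdapted (subE f 0 p) B)
    (heven : 5 ≤ p → EvenCrossTermsVanish f 0 (subE f 0 p)) :
    (∀ h : Rd d,
      Tendsto (fun t : ℝ => (1 / t) *
          (f (0 + B (elemMul (powVec t (exponent (subE f 0 p))) h)) - f 0))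
        (𝓝[>] 0) (𝓝 (limitFun f 0 (subE f 0 p) B h))) ∧
    NonconstantInEachVariable (limitFun f 0 (subE f 0 p) B) ∧
    (Coercive (limitFun f 0 (subE f 0 p) B) →
      Integrable (fun x => Real.exp (-limitFun f 0 (subE f 0 p) B x)) ∧
      ∀ (Ω : Set.Ioc (0 : ℝ) 1 → Type*) [∀ t, MeasurableSpace (Ω t)]
        (P : ∀ t, Measure (Ω t)) [∀ t, IsProbabilityMeasure (P t)]
        (X : ∀ t, Ω t → Rd d)
        (Ω' : Type*) [MeasurableSpace Ω'] (P' : Measure Ω') [IsProbabilityMeasure P']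
        (Y : Ω' → Rd d),
        (∀ t, HasLaw (X t) (gibbs f t) (P t)) →
        HasLaw Y (expNegLaw (limitFun f 0 (subE f 0 p) B)) P' →
        TendstoInDistribution
          (fun (t : Set.Ioc (0 : ℝ) 1) ω => elemMul (invPowVec t (exponent (subE f 0 p))) (B.symm (X t ω)))
          (comap (fun t : Set.Ioc (0 : ℝ) 1 => (t : ℝ)) (𝓝 0)) Y P P') := by
  have hnonneg : ∀ x, 0 ≤ f x := fun x => by
    have h0 : (0 : Rd d) ∈ argmin f := by rw [hargmin]; rfl
    exact hf0 ▸ h0 x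
  obtain ⟨m, hm, hα, hlim, hhom, hnc⟩ : ∃ m : Fin d → ℕ, (∀ i, 1 ≤ m i) ∧
      (∀ i, exponent (subE f 0 p) i = 1 / (2 * m i : ℝ)) ∧
      (∀ h₀, Tendsto (fun q : ℝ × Rd d =>
        f (B (elemMul (powVec q.1 (exponent (subE f 0 p))) q.2)) / q.1)
        (𝓝[>] 0 ×ˢ 𝓝 h₀) (𝓝 (limitFun f 0 (subE f 0 p) B h₀))) ∧
      (∀ t, 0 < t → ∀ h, limitFun f 0 (subE f 0 p) B
        (elemMul (powVec t (exponent (subE f 0 p))) h) = t * limitFun f 0 (subE f 0 p) B h) ∧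
      NonconstantInEachVariable (limitFun f 0 (subE f 0 p) B) := by
    -- In dimension 0 positivity of the Taylor polynomial is vacuous, so minimality forces p = 0 and
    -- f and g are zero. In positive dimension p = 0 is impossible: the empty Taylor sum is not
    -- positive.
    rcases Nat.eq_zero_or_pos d with rfl | hd
    · have hp : p = 0 := Nat.le_zero.1 <| hstrict.isLeast.2
        ⟨1, one_pos, fun h _ hne => absurd (Subsingleton.elim h 0) hne⟩
      subst hp
      have hlim0 : ∀ h, limitFun f 0 (subE f 0 0) B h = 0 := fun h => by simp [limitFun]
      have hfz : ∀ x, f x = 0 := fun x => by rw [Subsingleton.elim x 0, hf0]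
      exact ⟨fun _ => 1, fun _ => le_rfl, fun i => i.elim0, fun h₀ => by
        simp only [hlim0, hfz, zero_div]; exact tendsto_const_nhds,
        fun t _ h => by simp [hlim0], fun i => i.elim0⟩
    · have hp : p ≠ 0 := by
        rintro rfl
        obtain ⟨r, hr, hpos⟩ := hstrict.isLeast.1
        have : Nonempty (Fin d) := ⟨⟨0, hd⟩⟩
        have hnt : (0 : Rd d) ∈ closure ({0}ᶜ : Set (Rd d)) :=
          (dense_compl_singleton (0 : Rd d)) 0
        obtain ⟨h, hh, hhr⟩ := Metric.mem_closure_iff.1 hnt r hr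
        have := hpos h (by rwa [Metric.mem_ball, dist_comm]) hh
        simp at this
      obtain ⟨b, hBb, hα, hlim, hhom⟩ := exists_block_data hf hnonneg hf0 hB heven hp
      -- The shift by one turns the zero-based block number into m_i with α_i = 1/(2m_i).
      exact ⟨fun i => b i + 1, fun i => Nat.succ_pos _, fun i => by rw [hα]; push_cast; rfl, hlim,
        hhom, nonconstantInEachVariable_limitFun hf hstrict.isLeast.1 hBb⟩
  refine ⟨fun h => ?_, hnc, fun hG => ⟨integrable_exp_neg_of_coercive hm hα continuous_limitFun hG
    hhom, ?_⟩⟩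
  · have hpair : Tendsto (fun t : ℝ => (t, h)) (𝓝[>] 0) (𝓝[>] 0 ×ˢ 𝓝 h) :=
      tendsto_id.prodMk tendsto_const_nhds
    refine ((hlim h).comp hpair).congr fun t => ?_
    simp only [Function.comp_apply, hf0, sub_zero, zero_add]
    ring
  · intro Ω _ P _ X Ω' _ P' _ Y hX hY
    exact tendstoInDistribution_rescaled_gibbs hm hα hf.continuous hcoercive hf0 hargmin hint hlim
      continuous_limitFun hG hhom Ω P X Ω' P' Y hX hY
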